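/- Let $V_0,a\ge 0$, $b,c\in\mathbb R$, and let $0=t_0<t_1<\dots<t_n=T$. Throughout, for $b=0$ read $\frac{e^{bx}-1}{b}:=x$ and $\frac1b\big(\frac{e^{bx}-1}{b}-x\big):=\frac{x^2}{2}$. *Square-root process.* Let $V\ge 0$ be a continuous adapted solution of $V_t=V_0+\int_0^t(a+bV_s)\,ds+c\int_0^t\sqrt{V_s}\,dW_s$, with $W$ a standard Brownian motion relative to the given filtration, and put $U_{s,t}=\int_s^tV_r\,dr$ and $Z_{s,t}=\int_s^t\sqrt{V_r}\,dW_r$ (Itô integral). *The iVi scheme* (for $c\neq0$). Put $\widehat V_0=V_0$ and, for $i=0,\dots,n-1$, with $\Delta_i=t_{i+1}-t_i$, $$\alpha_i=\widehat V_i\,\frac{e^{b\Delta_i}-1}{b}+\frac ab\Big(\frac{e^{b\Delta_i}-1}{b}-\Delta_i\Big),\qquad \sigma_i=c\,\frac{e^{b\Delta_i}-1}{b}.$$ Conditionally on the past up to step $i$, draw $\widehat U_{i,i+1}\sim IG\big(\alpha_i,(\alpha_i/\sigma_i)^2\big)$, and set $$\widehat Z_{i,i+1}=\frac{1}{\sigma_i}\big(\widehat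 U_{i,i+1}-\alpha_i\big),\qquad \widehat V_{i+1}=\widehat V_i+a\Delta_i+b\,\widehat U_{i,i+1}+c\,\widehat Z_{i,i+1}.$$ Here $IG(\mu,\lambda)$, for $\mu,\lambda>0$, is the Inverse Gaussian distribution, with density $\sqrt{\frac{\lambda}{2\pi x^3}}\exp\big(-\frac{\lambda(x-\mu)^2}{2\mu^2x}\big)$ on $x>0$, and $IG(0,0)$ is the Dirac mass at $0$. **Proposition.** Let $i\in\{0,\dots,n-1\}$, $v\ge 0$ and $\Delta=t_{i+1}-t_i$. All the random variables below are integrable, and \begin{align*} \mathbb E\big[\widehat U_{i,i+1}\mid\widehat V_i=v\big]&=\mathbb E\big[U_{t_i,t_{i+1}}\mid V_{t_i}=v\big]=v\,\frac{e^{b\Delta}-1}{b}+\frac ab\Big(\frac{e^{b\Delta}-1}{b}-\Delta\Big),\\ \mathbb E\big[\widehat Z_{i,i+1}\mid\widehat V_i=v\big]&=\mathbb E\big[Z_{t_i,t_{i+1}}\mid V_{t_i}=v\big]=0,\\ \mathbb E\big[\widehat V_{i+1}\mid\widehat V_i=v\big]&=\mathbb E\big[V_{t_{i+1}}\mid V_{t_i}=v\big]=v\,e^{b\Delta}+\frac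 ab\big(e^{b\Delta}-1\big), \end{align*} where the identities for the process hold for every $c\in\mathbb R$ and those for the scheme for every $c\ne 0$. An identity $\mathbb E[X\mid Y=v]=g(v)$ means both that $\mathbb E[X\mid\sigma(Y)]=g(Y)$ almost surely, and that for every $v\ge0$ the expectation of $X$ is $g(v)$ when the scheme, respectively the process, is started at time $t_i$ from the value $v$. -/

import Mathlib

open MeasureTheory ProbabilityTheory
open scoped NNReal ENNReal

noncomputable section

namespace SquareRoot

/-! ### Elementary functions -/

/-- `(e^{bx} - 1) / b`, with the value `x` for `b = 0`. -/
def phi (b x : ℝ) : ℝ := if b = 0 then x else (Real.exp (b * x) - 1) / b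

/-- `((e^{bx} - 1) / b - x) / b`, with the value `x² / 2` for `b = 0`. -/
def psi (b x : ℝ) : ℝ := if b = 0 then x ^ 2 / 2 else ((Real.exp (b * x) - 1) / b - x) / b

/-! ### The Inverse Gaussian distribution -/

/-- Density on `(0, ∞)` of the Inverse Gaussian distribution with mean parameter `μ` and shape
parameter `l`. -/
def igDensity (μ l x : ℝ) : ℝ :=
  Real.sqrt (l / (2 * Real.pi * x ^ 3)) * Real.exp (-(l * (x - μ) ^ 2) / (2 * μ ^ 2 * x))

/-- The Inverse Gaussian distribution `IG(μ, l)` for `μ, l > 0`; by convention `IG(0, 0)` is the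
Dirac mass at `0` (and so is, as a mere default, `IG(μ, l)` for all other parameters). -/
def inverseGaussian (μ l : ℝ) : Measure ℝ :=
  if 0 < μ ∧ 0 < l then
    (volume.restrict (Set.Ioi 0)).withDensity fun x => ENNReal.ofReal (igDensity μ l x)
  else Measure.dirac 0

/-! ### The iVi scheme -/

/-- `α = v (e^{bx} - 1)/b + (a/b) ((e^{bx} - 1)/b - x)`: mean parameter for a step of length `x`
started from `v`. -/
def iviAlpha (a b x v : ℝ) : ℝ := v * phi b x + a * psi b x

/-- `σ = c (e^{bx} - 1)/b` for a step of length `x`. -/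
def iviSigma (b c x : ℝ) : ℝ := c * phi b x

/-- `(V, U, Z)` follows the iVi scheme along the grid `t 0 < ⋯ < t n`, started at the grid index `k`
from the value `x`. The time-step `i` goes from `t i` (`i.castSucc`) to `t (i + 1)` (`i.succ`);
`ℱ i` is the information available at the grid time `t i`, and to simulate `U i` from
`IG(α, (α / σ) ^ 2)` means that this is the conditional distribution of `U i` given `ℱ i`. -/
structure IsIViScheme {Ω : Type*} {mΩ : MeasurableSpace Ω} (P : Measure Ω) (a b c : ℝ) {n : ℕ}
    (t : Fin (n + 1) → ℝ≥0) (k : Fin (n + 1)) (x : ℝ) (ℱ : Filtration (Fin (n + 1)) mΩ)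
    (V : Fin (n + 1) → Ω → ℝ) (U Z : Fin n → Ω → ℝ) : Prop where
  measurable_V : ∀ i, k ≤ i → Measurable[ℱ i] (V i)
  measurable_U : ∀ i : Fin n, k ≤ i.castSucc → Measurable[ℱ i.succ] (U i)
  measurable_Z : ∀ i : Fin n, k ≤ i.castSucc → Measurable[ℱ i.succ] (Z i)
  init : ∀ᵐ ω ∂P, V k ω = x
  law_U : ∀ i : Fin n, k ≤ i.castSucc → ∀ B : Set ℝ, MeasurableSet B →
    P[(U i ⁻¹' B).indicator (fun _ => (1 : ℝ)) | ℱ i.castSucc] =ᵐ[P] fun ω =>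
      (inverseGaussian (iviAlpha a b (t i.succ - t i.castSucc) (V i.castSucc ω))
        ((iviAlpha a b (t i.succ - t i.castSucc) (V i.castSucc ω) /
          iviSigma b c (t i.succ - t i.castSucc)) ^ 2)).real B
  def_Z : ∀ i : Fin n, k ≤ i.castSucc → ∀ᵐ ω ∂P,
    Z i ω = 1 / iviSigma b c (t i.succ - t i.castSucc) *
      (U i ω - iviAlpha a b (t i.succ - t i.castSucc) (V i.castSucc ω))
  def_V : ∀ i : Fin n, k ≤ i.castSucc → ∀ᵐ ω ∂P,
    V i.succ ω = V i.castSucc ω + a * (t i.succ - t i.castSucc) + b * U i ω + c * Z i ω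

/-! ### Stochastic integral and square-root process -/

/-- `W` is a standard Brownian motion with respect to the filtration `ℱ`. -/
structure IsFilteredBrownian {Ω : Type*} {mΩ : MeasurableSpace Ω} (P : Measure Ω)
    (ℱ : Filtration ℝ≥0 mΩ) (W : ℝ≥0 → Ω → ℝ) : Prop where
  isBrownian : IsBrownianReal W P
  adapted : ∀ t, Measurable[ℱ t] (W t)
  indep : ∀ s t, s ≤ t →
    Indep (MeasurableSpace.comap (fun ω => W t ω - W s ω) inferInstance) (ℱ s) P

/-- `π 0 ≤ π 1 ≤ ⋯ ≤ π N` is a subdivision of `[s, T]` of mesh at most `δ`. -/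
structure IsSubdivision (s T : ℝ≥0) (δ : ℝ) (N : ℕ) (π : ℕ → ℝ≥0) : Prop where
  mono : Monotone π
  left : π 0 = s
  right : π N = T
  mesh : ∀ k, k < N → (π (k + 1) : ℝ) - π k ≤ δ

/-- The elementary stochastic integral up to time `u` of the step process which equals `H (π k)` on
`(π k, π (k + 1)]`, `k < N`. -/
def elemIntegral {Ω : Type*} (H W : ℝ≥0 → Ω → ℝ) (N : ℕ) (π : ℕ → ℝ≥0) (u : ℝ≥0) (ω : Ω) : ℝ :=
  ∑ k ∈ Finset.range N, H (π k) ω * (W (min (π (k + 1)) u) ω - W (min (π k) u) ω)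

/-- `I u = ∫ₛᵘ H dW` for all `u ≥ s`, for a continuous adapted integrand `H`: the elementary
integrals of `H` along subdivisions converge to `I`, uniformly on every `[s, T]`, in probability,
as the mesh tends to `0`. -/
def IsItoIntegral {Ω : Type*} {mΩ : MeasurableSpace Ω} (P : Measure Ω) (H W : ℝ≥0 → Ω → ℝ)
    (s : ℝ≥0) (I : ℝ≥0 → Ω → ℝ) : Prop :=
  ∀ T : ℝ≥0, s ≤ T → ∀ ε : ℝ, 0 < ε → ∀ η : ℝ, 0 < η → ∃ δ : ℝ, 0 < δ ∧
    ∀ (N : ℕ) (π : ℕ → ℝ≥0), IsSubdivision s T δ N π →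
      P {ω | ∃ u, s ≤ u ∧ u ≤ T ∧ ε ≤ |elemIntegral H W N π u ω - I u ω|} ≤ ENNReal.ofReal η

/-- `V` is a (weak) solution on `[s, ∞)`, started from `x` at time `s`, of
`V t = x + ∫ₛᵗ (a + b V r) dr + c ∫ₛᵗ √(V r) dW r`, and `M t = ∫ₛᵗ √(V r) dW r`. -/
structure IsSquareRootProcess {Ω : Type*} {mΩ : MeasurableSpace Ω} (P : Measure Ω)
    (a b c : ℝ) (s : ℝ≥0) (x : ℝ) (ℱ : Filtration ℝ≥0 mΩ) (W V M : ℝ≥0 → Ω → ℝ) : Prop where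
  brownian : IsFilteredBrownian P ℱ W
  adapted : ∀ t, s ≤ t → Measurable[ℱ t] (V t)
  continuous : ∀ᵐ ω ∂P, ContinuousOn (fun t => V t ω) (Set.Ici s)
  nonneg : ∀ᵐ ω ∂P, ∀ t, s ≤ t → 0 ≤ V t ω
  integral : IsItoIntegral P (fun t ω => Real.sqrt (V t ω)) W s M
  init : ∀ᵐ ω ∂P, V s ω = x
  sde : ∀ᵐ ω ∂P, ∀ t, s ≤ t →
    V t ω = x + (∫ r in (s : ℝ)..t, (a + b * V r.toNNReal ω)) + c * M t ω

/-- The integrated process `∫ₛᵗ V r dr`. -/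
def timeIntegral {Ω : Type*} (V : ℝ≥0 → Ω → ℝ) (s t : ℝ≥0) (ω : Ω) : ℝ :=
  ∫ r in (s : ℝ)..t, V r.toNNReal ω

/-! ### Conditional means -/

/-- `𝔼[X | Y = y] = g y`: `X` is integrable and `𝔼[X | σ(Y)] = g(Y)` almost surely. -/
def HasCondMean {Ω : Type*} [MeasurableSpace Ω] (P : Measure Ω) (X Y : Ω → ℝ)
    (g : ℝ → ℝ) : Prop :=
  Integrable X P ∧ P[X | MeasurableSpace.comap Y inferInstance] =ᵐ[P] fun ω => g (Y ω)

/-- `X` is integrable with expectation `m`. -/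
def HasMean {Ω : Type*} [MeasurableSpace Ω] (P : Measure Ω) (X : Ω → ℝ) (m : ℝ) : Prop :=
  Integrable X P ∧ ∫ ω, X ω ∂P = m

end SquareRoot

end

noncomputable section

namespace SquareRoot

open Filter Topology

/-! ### Calculus of `phi` and `psi` -/

/-! Every conditional mean is obtained from integrals over events `A` of the past at the start of
the step. The right-hand sides depend on the present value only, so such identities also give the
conditioning on that value, and `A = Set.univ` gives the version with a deterministic start. The
functions `phi` and `psi` enter only through `b * phi = exp (b x) - 1`, `b * psi = phi - x` and
their derivatives, which treats `b = 0` together with the rest.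

Scheme: the substitution `x ↦ μ² / x` shows that the Inverse Gaussian law has first moment `μ` times
its mass, and the mass is one because the law is a conditional distribution. Hence the mean of `U`
is that of `α`, `Z` is centred, and the mean of the next value follows by linearity. This needs `α ≥
0`, hence nonnegativity of the scheme, which holds because the next value is a nonnegative constant
plus a positive multiple of `U` (`IsIViScheme.nonneg_integrable`).

Process: the point is that the Itô integral, given only as a limit in probability of elementary
integrals, is a true martingale. Stopping the elementary integrals when the path is seen above a
level `m` makes them centred and bounded in `L²`. Pathwise they dominate asymptotically the killed
process minus its drift, so the mean of the killed process satisfies a Gronwall inequality with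
constants independent of `m`. Letting `m → ∞`, Fatou bounds the mean of `V` on compact intervals. By
the Itô isometry the unstopped elementary integrals of `√V` are then bounded in `L²`, and integrals
over past events pass to the limit (`setIntegral_martingale`).

Consequently `f r = 𝔼[1_A V_r]` solves `f r = f s + a P(A) (r - s) + b ∫ f`, whose bounded solution
is unique. Its explicit form gives the mean of the process, and its integral in time gives that of
the integrated process. -/

lemma mul_phi (b x : ℝ) : b * phi b x = Real.exp (b * x) - 1 := by
  unfold phi
  split_ifs with h
  · simp [h]
  · field_simp

lemma mul_psi (b x : ℝ) : b * psi b x = phi b x - x := by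
  unfold psi phi
  split_ifs with h
  · simp [h]
  · field_simp

@[simp] lemma phi_zero (b : ℝ) : phi b 0 = 0 := by simp [phi]

@[simp] lemma psi_zero (b : ℝ) : psi b 0 = 0 := by simp [psi]

lemma hasDerivAt_phi (b x : ℝ) : HasDerivAt (phi b) (Real.exp (b * x)) x := by
  by_cases h : b = 0
  · have : phi b = fun x => x := by ext; simp [phi, h]
    rw [this, h]
    exact (hasDerivAt_id' x).congr_deriv (by simp)
  · have : phi b = fun x => (Real.exp (b * x) - 1) / b := by ext; simp [phi, h]
    rw [this]
    refine ((((hasDerivAt_id' x).const_mul b).exp.sub_const 1).div_const b).congr_deriv ?_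
    field_simp

lemma hasDerivAt_psi (b x : ℝ) : HasDerivAt (psi b) (phi b x) x := by
  by_cases h : b = 0
  · have : psi b = fun x => x ^ 2 / 2 := by ext; simp [psi, h]
    rw [this]
    exact ((hasDerivAt_pow 2 x).div_const 2).congr_deriv (by simp [phi, h])
  · have : psi b = fun x => (phi b x - x) / b := by ext; simp [phi, psi, h]
    rw [this]
    refine (((hasDerivAt_phi b x).sub (hasDerivAt_id' x)).div_const b).congr_deriv ?_
    rw [← mul_phi]
    field_simp

lemma phi_strictMono (b : ℝ) : StrictMono (phi b) :=
  strictMono_of_hasDerivAt_pos (hasDerivAt_phi b) fun _ => Real.exp_pos _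

lemma phi_pos (b : ℝ) {x : ℝ} (hx : 0 < x) : 0 < phi b x := by
  simpa using phi_strictMono b hx

lemma phi_nonneg (b : ℝ) {x : ℝ} (hx : 0 ≤ x) : 0 ≤ phi b x := by
  simpa using (phi_strictMono b).monotone hx

lemma psi_nonneg (b : ℝ) {x : ℝ} (hx : 0 ≤ x) : 0 ≤ psi b x := by
  have : MonotoneOn (psi b) (Set.Ici 0) := monotoneOn_of_deriv_nonneg (convex_Ici 0)
    (fun y _ => (hasDerivAt_psi b y).continuousAt.continuousWithinAt)
    (fun y _ => (hasDerivAt_psi b y).differentiableAt.differentiableWithinAt)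
    (fun y hy => by
      rw [(hasDerivAt_psi b y).deriv]
      exact phi_nonneg b (interior_subset hy))
  simpa using this (Set.self_mem_Ici) hx hx

/-- The difference `y * phi b y - psi b y` vanishes at `0` and has derivative `y * exp (b * y)`. The
inequality makes the constant term of a step of the scheme nonnegative. -/
lemma psi_le_mul_phi (b : ℝ) {x : ℝ} (hx : 0 ≤ x) : psi b x ≤ x * phi b x := by
  have hd (y : ℝ) : HasDerivAt (fun y => y * phi b y - psi b y) (y * Real.exp (b * y)) y := by
    exact (((hasDerivAt_id' y).mul (hasDerivAt_phi b y)).sub (hasDerivAt_psi b y)).congr_deriv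
      (by simp)
  have : MonotoneOn (fun y => y * phi b y - psi b y) (Set.Ici 0) :=
    monotoneOn_of_deriv_nonneg (convex_Ici 0)
    (fun y _ => (hd y).continuousAt.continuousWithinAt)
    (fun y _ => (hd y).differentiableAt.differentiableWithinAt)
    (fun y hy => by
      rw [(hd y).deriv]
      exact mul_nonneg (interior_subset hy) (Real.exp_pos _).le)
  simpa using this (Set.self_mem_Ici) hx hx

lemma continuous_phi (b : ℝ) : Continuous (phi b) :=
  continuous_iff_continuousAt.2 fun x => (hasDerivAt_phi b x).continuousAt

lemma integral_exp_sub (b s t : ℝ) :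
    ∫ r in s..t, Real.exp (b * (r - s)) = phi b (t - s) := by
  rw [intervalIntegral.integral_comp_sub_right (fun x => Real.exp (b * x)),
    intervalIntegral.integral_eq_sub_of_hasDerivAt (fun x _ => hasDerivAt_phi b x)
      (Continuous.intervalIntegrable (by fun_prop) _ _)]
  simp

lemma integral_phi_sub (b s t : ℝ) :
    ∫ r in s..t, phi b (r - s) = psi b (t - s) := by
  rw [intervalIntegral.integral_comp_sub_right (phi b),
    intervalIntegral.integral_eq_sub_of_hasDerivAt (fun x _ => hasDerivAt_psi b x)
      ((continuous_phi b).intervalIntegrable _ _)]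
  simp

/-! ### Conditional means -/

/-- Since `σ(Y) ⊆ m` and `g(Y)` is `σ(Y)`-measurable, averaging over the larger σ-algebra is enough;
no Markov property has to be invoked. -/
lemma hasCondMean_of_setIntegral {Ω : Type*} {m mΩ : MeasurableSpace Ω} {P : Measure Ω}
    [IsProbabilityMeasure P] (hm : m ≤ mΩ) {X Y : Ω → ℝ} {g : ℝ → ℝ} (hY : Measurable[m] Y)
    (hg : Measurable g) (hX : Integrable X P)
    (hgY : Integrable (fun ω => g (Y ω)) P)
    (h : ∀ A, MeasurableSet[m] A → ∫ ω in A, X ω ∂P = ∫ ω in A, g (Y ω) ∂P) :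
    HasCondMean P X Y g := by
  have hle : MeasurableSpace.comap Y inferInstance ≤ m := hY.comap_le
  refine ⟨hX, (ae_eq_condExp_of_forall_setIntegral_eq (hle.trans hm) hX
    (fun A _ _ => hgY.integrableOn) (fun A hA _ => (h A (hle A hA)).symm) ?_).symm⟩
  exact (hg.comp (comap_measurable Y)).stronglyMeasurable.aestronglyMeasurable

/-! ### Moments of the Inverse Gaussian distribution -/

lemma measurable_igDensity : Measurable fun p : (ℝ × ℝ) × ℝ => igDensity p.1.1 p.1.2 p.2 := by
  unfold igDensity
  fun_prop

lemma measurable_inverseGaussian {Ω : Type*} {mΩ : MeasurableSpace Ω} {μ l : Ω → ℝ}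
    (hμ : Measurable μ) (hl : Measurable l) :
    Measurable fun ω => inverseGaussian (μ ω) (l ω) := by
  have hset : MeasurableSet {ω | 0 < μ ω ∧ 0 < l ω} :=
    (measurableSet_lt measurable_const hμ).inter (measurableSet_lt measurable_const hl)
  refine Measurable.ite hset ?_ measurable_const
  refine Measure.measurable_of_measurable_coe _ fun s hs => ?_
  simp_rw [withDensity_apply _ hs, Measure.restrict_restrict hs]
  refine Measurable.lintegral_prod_right'
    (f := fun p : Ω × ℝ => ENNReal.ofReal (igDensity (μ p.1) (l p.1) p.2)) ?_
  exact (measurable_igDensity.comp (((hμ.comp measurable_fst).prodMk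
    (hl.comp measurable_fst)).prodMk measurable_snd)).ennreal_ofReal

lemma inverseGaussian_Iio (μ l : ℝ) : inverseGaussian μ l (Set.Iio 0) = 0 := by
  unfold inverseGaussian
  split_ifs with h
  · rw [withDensity_apply _ measurableSet_Iio, Measure.restrict_restrict measurableSet_Iio]
    have : Set.Iio (0 : ℝ) ∩ Set.Ioi 0 = ∅ := by
      ext x
      simp only [Set.mem_inter_iff, Set.mem_Iio, Set.mem_Ioi, Set.mem_empty_iff_false]
      grind
    simp [this]
  · simp

/-- The exponent is invariant under `x ↦ μ² / x`, so only powers of `x` change. The factor `μ² / x²`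
is the Jacobian of this involution. -/
lemma igDensity_reflect {μ l x : ℝ} (hμ : 0 < μ) (hl : 0 < l) (hx : 0 < x) :
    μ ^ 2 / x ^ 2 * (μ ^ 2 / x * igDensity μ l (μ ^ 2 / x)) = μ * igDensity μ l x := by
  have he : -(l * (μ ^ 2 / x - μ) ^ 2) / (2 * μ ^ 2 * (μ ^ 2 / x)) =
      -(l * (x - μ) ^ 2) / (2 * μ ^ 2 * x) := by
    field_simp
    ring
  have hs : Real.sqrt (l / (2 * Real.pi * (μ ^ 2 / x) ^ 3)) =
      x ^ 3 / μ ^ 3 * Real.sqrt (l / (2 * Real.pi * x ^ 3)) := by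
    have : l / (2 * Real.pi * (μ ^ 2 / x) ^ 3) =
        (x ^ 3 / μ ^ 3) ^ 2 * (l / (2 * Real.pi * x ^ 3)) := by
      field_simp
    rw [this, Real.sqrt_mul (by positivity), Real.sqrt_sq (by positivity)]
  unfold igDensity
  rw [he, hs]
  field_simp

/-- The substitution `x ↦ μ² / x` shows that the first moment is `μ` times the total mass. -/
lemma lintegral_inverseGaussian {μ l : ℝ} (hμ : 0 ≤ μ) (hl : 0 < μ → 0 < l) :
    ∫⁻ x, ENNReal.ofReal x ∂inverseGaussian μ l =
      ENNReal.ofReal μ * inverseGaussian μ l Set.univ := by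
  unfold inverseGaussian
  split_ifs with h
  · have hm : Measurable fun x => igDensity μ l x :=
      measurable_igDensity.comp (f := fun x : ℝ => ((μ, l), x)) (by fun_prop)
    have himg : (fun x => μ ^ 2 / x) '' Set.Ioi 0 = Set.Ioi 0 := by
      ext y
      simp only [Set.mem_image, Set.mem_Ioi]
      constructor
      · rintro ⟨x, hx, rfl⟩
        have := h.1
        positivity
      · intro hy
        have := h.1
        exact ⟨μ ^ 2 / y, by positivity, by field_simp⟩
    have hinj : Set.InjOn (fun x => μ ^ 2 / x) (Set.Ioi 0) := by
      intro x hx y hy hxy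
      have hx' : (0 : ℝ) < x := hx
      have hy' : (0 : ℝ) < y := hy
      have := h.1
      field_simp at hxy
      exact hxy.symm
    have hder : ∀ x ∈ Set.Ioi (0 : ℝ),
        HasDerivWithinAt (fun x => μ ^ 2 / x) (-(μ ^ 2 / x ^ 2)) (Set.Ioi 0) x := by
      intro x hx
      have hx' : (0 : ℝ) < x := hx
      have := ((hasDerivAt_const x (μ ^ 2)).div (hasDerivAt_id' x) hx'.ne').hasDerivWithinAt
        (s := Set.Ioi 0)
      refine this.congr_deriv ?_
      simp [neg_div]
    have hsub := lintegral_image_eq_lintegral_abs_deriv_mul measurableSet_Ioi hder hinj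
      (fun x => ENNReal.ofReal (x * igDensity μ l x))
    rw [himg] at hsub
    rw [lintegral_withDensity_eq_lintegral_mul _ hm.ennreal_ofReal ENNReal.measurable_ofReal,
      withDensity_apply _ MeasurableSet.univ, Measure.restrict_univ]
    rw [← lintegral_const_mul _ hm.ennreal_ofReal]
    trans ∫⁻ x in Set.Ioi 0, ENNReal.ofReal (x * igDensity μ l x)
    · refine setLIntegral_congr_fun measurableSet_Ioi fun x hx => ?_
      simp only [Pi.mul_apply]
      rw [mul_comm, ENNReal.ofReal_mul (le_of_lt hx)]
    · rw [hsub]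
      refine setLIntegral_congr_fun measurableSet_Ioi fun x hx => ?_
      have hx' : (0 : ℝ) < x := hx
      rw [← ENNReal.ofReal_mul (abs_nonneg _), ← ENNReal.ofReal_mul hμ, abs_neg,
        abs_of_nonneg (by positivity), igDensity_reflect h.1 h.2 hx']
  · have : μ = 0 := by
      by_contra h0
      have h1 : 0 < μ := lt_of_le_of_ne hμ (Ne.symm h0)
      exact h ⟨h1, hl h1⟩
    simp [this]

/-! ### One step of the scheme -/

/-- Over a past event, `U` is distributed as the mixture of its conditional laws, so its integral is
the integral of their means. Everything is done with lower integrals first, so that integrability of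
`U` is a by-product of that of `μ`. -/
lemma setIntegral_of_law_inverseGaussian {Ω : Type*} {m mΩ : MeasurableSpace Ω} {P : Measure Ω}
    [IsProbabilityMeasure P] (hm : m ≤ mΩ) {U μ l : Ω → ℝ} (hU : Measurable U)
    (hμ : Measurable[m] μ) (hl : Measurable[m] l)
    (hlaw : ∀ B : Set ℝ, MeasurableSet B → P[(U ⁻¹' B).indicator (fun _ => (1 : ℝ)) | m] =ᵐ[P]
      fun ω => (inverseGaussian (μ ω) (l ω)).real B)
    (hpos : ∀ᵐ ω ∂P, 0 ≤ μ ω ∧ (0 < μ ω → 0 < l ω)) (hint : Integrable μ P) :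
    (∀ᵐ ω ∂P, 0 ≤ U ω) ∧ Integrable U P ∧
      ∀ A, MeasurableSet[m] A → ∫ ω in A, U ω ∂P = ∫ ω in A, μ ω ∂P := by
  set κ : Ω → Measure ℝ := fun ω => inverseGaussian (μ ω) (l ω) with hκ
  have hκm : Measurable κ :=
    measurable_inverseGaussian (hμ.mono hm le_rfl) (hl.mono hm le_rfl)
  -- The normalisation of the density is not computed: the conditional probability of the sure event
  -- is one.
  have hone : ∀ᵐ ω ∂P, κ ω Set.univ = 1 := by
    have h1 := hlaw Set.univ MeasurableSet.univ
    simp only [Set.preimage_univ, Set.indicator_univ] at h1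
    rw [condExp_const hm] at h1
    filter_upwards [h1] with ω hω
    have h2 : (κ ω).real Set.univ = 1 := hω.symm
    rw [measureReal_def] at h2
    rw [← ENNReal.ofReal_toReal (a := κ ω Set.univ) (fun h => by simp [h] at h2), h2]
    simp
  have hbind : ∀ A, MeasurableSet[m] A → (P.restrict A).map U = (P.restrict A).bind κ := by
    intro A hA
    ext B hB
    rw [Measure.map_apply hU hB, Measure.bind_apply hB hκm.aemeasurable]
    have h1 : ∫ ω in A, (U ⁻¹' B).indicator (fun _ => (1 : ℝ)) ω ∂P =
        ∫ ω in A, (κ ω).real B ∂P := by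
      rw [← setIntegral_condExp hm ((integrable_const (1 : ℝ)).indicator (hU hB)) hA]
      exact integral_congr_ae (ae_restrict_of_ae (hlaw B hB))
    have h2 : ∫ ω in A, (U ⁻¹' B).indicator (fun _ => (1 : ℝ)) ω ∂P =
        (P.restrict A).real (U ⁻¹' B) := by
      rw [integral_indicator (hU hB)]
      simp
    have h3 : ∫⁻ ω in A, κ ω B ∂P = ∫⁻ ω in A, ENNReal.ofReal ((κ ω).real B) ∂P := by
      refine lintegral_congr_ae (ae_restrict_of_ae ?_)
      filter_upwards [hone] with ω hω
      rw [measureReal_def, ENNReal.ofReal_toReal]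
      exact ne_top_of_le_ne_top ENNReal.one_ne_top (hω ▸ measure_mono (Set.subset_univ B))
    have hmeas : Measurable fun ω => (κ ω).real B :=
      ((Measure.measurable_coe hB).comp hκm).ennreal_toReal
    rw [h3, ← ofReal_integral_eq_lintegral_ofReal, ← h1, h2, measureReal_def,
      ENNReal.ofReal_toReal (measure_ne_top _ _)]
    · refine Integrable.of_bound (C := 1) hmeas.aestronglyMeasurable (ae_restrict_of_ae ?_)
      filter_upwards [hone] with ω hω
      rw [Real.norm_of_nonneg measureReal_nonneg, measureReal_def]
      exact ENNReal.toReal_le_of_le_ofReal zero_le_one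
        (by simpa using hω ▸ measure_mono (μ := κ ω) (Set.subset_univ B))
    · exact Eventually.of_forall fun ω => measureReal_nonneg
  have hlint : ∀ A, MeasurableSet[m] A →
      ∫⁻ ω in A, ENNReal.ofReal (U ω) ∂P = ∫⁻ ω in A, ENNReal.ofReal (μ ω) ∂P := by
    intro A hA
    rw [← lintegral_map (f := fun x => ENNReal.ofReal x) ENNReal.measurable_ofReal hU, hbind A hA,
      Measure.lintegral_bind hκm.aemeasurable ENNReal.measurable_ofReal.aemeasurable]
    refine lintegral_congr_ae (ae_restrict_of_ae ?_)
    filter_upwards [hone, hpos] with ω h1 h2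
    have := lintegral_inverseGaussian h2.1 h2.2
    rw [this]
    change _ * κ ω Set.univ = _
    rw [h1, mul_one]
  have hU0 : ∀ᵐ ω ∂P, 0 ≤ U ω := by
    have h1 := congrArg (fun ν => ν (Set.Iio 0)) (hbind Set.univ MeasurableSet.univ)
    simp only [Measure.restrict_univ] at h1
    rw [Measure.map_apply hU measurableSet_Iio,
      Measure.bind_apply measurableSet_Iio hκm.aemeasurable] at h1
    simp only [hκ, inverseGaussian_Iio, lintegral_zero] at h1
    rw [ae_iff]
    simpa [Set.preimage] using h1
  have hμ0 : ∀ᵐ ω ∂P, 0 ≤ μ ω := hpos.mono fun ω h => h.1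
  have hUint : Integrable U P := by
    refine ⟨hU.aestronglyMeasurable, ?_⟩
    rw [hasFiniteIntegral_iff_ofReal hU0]
    have := hlint Set.univ MeasurableSet.univ
    rw [Measure.restrict_univ] at this
    rw [this, ← hasFiniteIntegral_iff_ofReal hμ0]
    exact hint.2
  refine ⟨hU0, hUint, fun A hA => ?_⟩
  rw [integral_eq_lintegral_of_nonneg_ae (ae_restrict_of_ae hU0) hU.aestronglyMeasurable.restrict,
    integral_eq_lintegral_of_nonneg_ae (ae_restrict_of_ae hμ0) hint.1.restrict, hlint A hA]

section Step

variable {Ω : Type*} {mΩ : MeasurableSpace Ω} {P : Measure Ω} {a b c : ℝ} {n : ℕ}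
  {t : Fin (n + 1) → ℝ≥0}
  {k : Fin (n + 1)} {x : ℝ} {ℱ : Filtration (Fin (n + 1)) mΩ} {V : Fin (n + 1) → Ω → ℝ}
  {U Z : Fin n → Ω → ℝ}

/-- The step of the scheme, given that its starting value is nonnegative and integrable. -/
lemma IsIViScheme.step [IsProbabilityMeasure P] (h : IsIViScheme P a b c t k x ℱ V U Z)
    (ha : 0 ≤ a) (hc : c ≠ 0)
    (ht : StrictMono t) (i : Fin n) (hi : k ≤ i.castSucc) (hV : ∀ᵐ ω ∂P, 0 ≤ V i.castSucc ω)
    (hVint : Integrable (V i.castSucc) P) :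
    (∀ᵐ ω ∂P, 0 ≤ U i ω) ∧ Integrable (U i) P ∧
      ∀ A, MeasurableSet[ℱ i.castSucc] A → ∫ ω in A, U i ω ∂P =
        ∫ ω in A, iviAlpha a b (t i.succ - t i.castSucc) (V i.castSucc ω) ∂P := by
  have hd : (0 : ℝ) < t i.succ - t i.castSucc :=
    sub_pos.2 (NNReal.coe_lt_coe.2 (ht (Fin.castSucc_lt_succ)))
  have hphi := phi_pos b hd
  have hpsi := psi_nonneg b hd.le
  have hm : Measurable (iviAlpha a b (t i.succ - t i.castSucc)) := by
    unfold iviAlpha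
    fun_prop
  have hα : Measurable[ℱ i.castSucc]
      fun ω => iviAlpha a b (t i.succ - t i.castSucc) (V i.castSucc ω) :=
    hm.comp (h.measurable_V _ hi)
  refine setIntegral_of_law_inverseGaussian (ℱ.le _) ((h.measurable_U i hi).mono (ℱ.le _) le_rfl)
    hα ((hα.div_const _).pow_const 2) (h.law_U i hi) ?_ ?_
  · filter_upwards [hV] with ω hω
    refine ⟨by unfold iviAlpha; positivity, fun hp => ?_⟩
    have : iviSigma b c (t i.succ - t i.castSucc) ≠ 0 := mul_ne_zero hc hphi.ne'
    positivity
  · unfold iviAlpha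
    exact (hVint.mul_const _).add (integrable_const _)

/-- The quotient `c / σ` equals `1 / phi`, so `c` drops out of the recursion for `V` in terms of
`U`. -/
lemma IsIViScheme.V_succ (h : IsIViScheme P a b c t k x ℱ V U Z) (hc : c ≠ 0)
    (ht : StrictMono t) (i : Fin n) (hi : k ≤ i.castSucc) :
    ∀ᵐ ω ∂P, V i.succ ω = V i.castSucc ω + a * (t i.succ - t i.castSucc) + b * U i ω +
      (phi b (t i.succ - t i.castSucc))⁻¹ *
        (U i ω - iviAlpha a b (t i.succ - t i.castSucc) (V i.castSucc ω)) := by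
  have hd : (0 : ℝ) < t i.succ - t i.castSucc :=
    sub_pos.2 (NNReal.coe_lt_coe.2 (ht (Fin.castSucc_lt_succ)))
  have hphi := phi_pos b hd
  filter_upwards [h.def_V i hi, h.def_Z i hi] with ω h1 h2
  rw [h1, h2, iviSigma]
  field_simp

/-- Nonnegativity propagates along the grid and must be known before a step is taken: for a negative
`α` the default law would be a Dirac mass at `0`, whose mean is not `α`. -/
lemma IsIViScheme.nonneg_integrable [IsProbabilityMeasure P]
    (h : IsIViScheme P a b c t k x ℱ V U Z) (ha : 0 ≤ a) (hc : c ≠ 0) (ht : StrictMono t)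
    (hx : 0 ≤ x) (j : Fin (n + 1)) (hj : k ≤ j) :
    (∀ᵐ ω ∂P, 0 ≤ V j ω) ∧ Integrable (V j) P := by
  induction j using Fin.induction with
  | zero =>
    have hk : k = 0 := Fin.le_zero_iff.1 hj
    subst hk
    refine ⟨h.init.mono fun ω hω => hω ▸ hx, ?_⟩
    exact (integrable_const x).congr (h.init.mono fun ω hω => hω.symm)
  | succ i ih =>
    rcases eq_or_lt_of_le hj with rfl | hlt
    · refine ⟨h.init.mono fun ω hω => hω ▸ hx, ?_⟩
      exact (integrable_const x).congr (h.init.mono fun ω hω => hω.symm)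
    have hi : k ≤ i.castSucc := Fin.le_castSucc_iff.2 hlt
    obtain ⟨hV, hVint⟩ := ih hi
    obtain ⟨hU, hUint, -⟩ := h.step ha hc ht i hi hV hVint
    have hd : (0 : ℝ) < t i.succ - t i.castSucc :=
      sub_pos.2 (NNReal.coe_lt_coe.2 (ht (Fin.castSucc_lt_succ)))
    have hphi := phi_pos b hd
    have hV' := h.V_succ hc ht i hi
    constructor
    · filter_upwards [hU, hV'] with ω hω h1
      set d : ℝ := t i.succ - t i.castSucc
      -- The previous value cancels, since its coefficient in `α / phi` is one; the coefficient of
      -- `U` is `b + 1 / phi = exp (b d) / phi`.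
      have h2 : V i.succ ω = a * ((phi b d)⁻¹ * (d * phi b d - psi b d)) +
          Real.exp (b * d) * (phi b d)⁻¹ * U i ω := by
        have h3 : Real.exp (b * d) = b * phi b d + 1 := by linarith [mul_phi b d]
        rw [h1, h3, iviAlpha]
        field_simp
        ring
      have := psi_le_mul_phi b hd.le
      have : 0 ≤ d * phi b d - psi b d := by linarith
      rw [h2]
      positivity
    · refine Integrable.congr ?_ (hV'.mono fun ω hω => hω.symm)
      refine ((hVint.add (integrable_const _)).add (hUint.const_mul _)).add
        ((hUint.sub ?_).const_mul _)
      unfold iviAlpha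
      exact (hVint.mul_const _).add (integrable_const _)

/-- Integrals of the increments of the scheme over events known at the beginning of the step. -/
lemma IsIViScheme.setIntegral [IsProbabilityMeasure P] (h : IsIViScheme P a b c t k x ℱ V U Z)
    (ha : 0 ≤ a)
    (hc : c ≠ 0) (ht : StrictMono t) (hx : 0 ≤ x) (i : Fin n) (hi : k ≤ i.castSucc) :
    (Integrable (U i) P ∧ Integrable (Z i) P ∧ Integrable (V i.succ) P) ∧
    ∀ A, MeasurableSet[ℱ i.castSucc] A →
      ∫ ω in A, U i ω ∂P = ∫ ω in A, (V i.castSucc ω * phi b (t i.succ - t i.castSucc)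
        + a * psi b (t i.succ - t i.castSucc)) ∂P ∧
      ∫ ω in A, Z i ω ∂P = 0 ∧
      ∫ ω in A, V i.succ ω ∂P = ∫ ω in A, (V i.castSucc ω * Real.exp (b * (t i.succ - t i.castSucc))
        + a * phi b (t i.succ - t i.castSucc)) ∂P := by
  obtain ⟨hV, hVint⟩ := h.nonneg_integrable ha hc ht hx _ hi
  obtain ⟨-, hV1int⟩ := h.nonneg_integrable ha hc ht hx i.succ
    (hi.trans (Fin.castSucc_lt_succ).le)
  obtain ⟨-, hUint, hU⟩ := h.step ha hc ht i hi hV hVint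
  set d : ℝ := t i.succ - t i.castSucc
  have hαint : Integrable (fun ω => iviAlpha a b d (V i.castSucc ω)) P := by
    unfold iviAlpha
    exact (hVint.mul_const _).add (integrable_const _)
  have hZint : Integrable (Z i) P :=
    ((hUint.sub hαint).const_mul (1 / iviSigma b c d)).congr
      ((h.def_Z i hi).mono fun ω hω => hω.symm)
  refine ⟨⟨hUint, hZint, hV1int⟩, fun A hA => ?_⟩
  have hZ : ∫ ω in A, Z i ω ∂P = 0 := by
    rw [integral_congr_ae (ae_restrict_of_ae (h.def_Z i hi)), integral_const_mul,
      integral_sub hUint.integrableOn hαint.integrableOn, hU A hA]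
    simp [d]
  refine ⟨hU A hA, hZ, ?_⟩
  rw [integral_congr_ae (ae_restrict_of_ae (h.def_V i hi)), integral_add, integral_add,
    integral_const_mul, integral_const_mul, hZ, hU A hA, mul_zero, add_zero, ← integral_const_mul,
    ← integral_add]
  · refine integral_congr_ae (Eventually.of_forall fun ω => ?_)
    simp only [iviAlpha]
    -- This is `v + a d + b α = v * exp (b d) + a * phi b d`.
    linear_combination (V i.castSucc ω) * mul_phi b d + a * mul_psi b d
  · exact (hVint.add (integrable_const _)).integrableOn
  · exact (hαint.const_mul b).integrableOn
  · exact (hVint.add (integrable_const _)).integrableOn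
  · exact (hUint.const_mul b).integrableOn
  · exact ((hVint.add (integrable_const _)).add (hUint.const_mul b)).integrableOn
  · exact (hZint.const_mul c).integrableOn

end Step

/-! ### Limits of sequences bounded in `L²` -/

section SecondMoment

variable {Ω : Type*} {mΩ : MeasurableSpace Ω} {P : Measure Ω}

/-- Truncation of `x` to `[-K, K]`. -/
def trunc (K x : ℝ) : ℝ := max (-K) (min K x)

lemma continuous_trunc (K : ℝ) : Continuous (trunc K) := by
  unfold trunc
  fun_prop

lemma abs_trunc_le {K : ℝ} (hK : 0 ≤ K) (x : ℝ) : |trunc K x| ≤ K := by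
  unfold trunc
  grind

/-- The error is zero when `|x| ≤ K`, and otherwise at most `|x| ≤ x² / K`. Thus an `L²` bound
controls truncation errors in mean, uniformly along a sequence. -/
lemma abs_trunc_sub_le {K : ℝ} (hK : 0 < K) (x : ℝ) : |trunc K x - x| ≤ x ^ 2 / K := by
  rw [le_div_iff₀ hK]
  have hx : |x| ^ 2 = x ^ 2 := sq_abs x
  by_cases h : |x| ≤ K
  · have : trunc K x = x := by unfold trunc; grind
    rw [this]
    simp [sq_nonneg]
  · have : |trunc K x - x| ≤ |x| := by unfold trunc; grind
    nlinarith [abs_nonneg x, abs_nonneg (trunc K x - x)]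

lemma integrable_trunc [IsProbabilityMeasure P] {K : ℝ} (hK : 0 ≤ K) {X : Ω → ℝ}
    (hX : AEStronglyMeasurable X P) :
    Integrable (fun ω => trunc K (X ω)) P :=
  Integrable.of_bound ((continuous_trunc K).comp_aestronglyMeasurable hX) K
    (Eventually.of_forall fun _ => abs_trunc_le hK _)

lemma abs_setIntegral_trunc_sub_le [IsProbabilityMeasure P] {K C : ℝ} (hK : 0 < K) {X : Ω → ℝ}
    (hX : MemLp X 2 P)
    (hC : ∫ ω, X ω ^ 2 ∂P ≤ C) (A : Set Ω) :
    |∫ ω in A, trunc K (X ω) ∂P - ∫ ω in A, X ω ∂P| ≤ C / K := by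
  rw [← integral_sub (integrable_trunc hK.le hX.1).integrableOn
    (hX.integrable one_le_two).integrableOn]
  have hd : Integrable (fun ω => X ω ^ 2 / K) P := hX.integrable_sq.div_const K
  calc |∫ ω in A, (trunc K (X ω) - X ω) ∂P| ≤ ∫ ω in A, |trunc K (X ω) - X ω| ∂P :=
        abs_integral_le_integral_abs
    _ ≤ ∫ ω in A, X ω ^ 2 / K ∂P := by
        refine integral_mono_of_nonneg (Eventually.of_forall fun ω => abs_nonneg _)
          hd.integrableOn (Eventually.of_forall fun ω => abs_trunc_sub_le hK _)
    _ ≤ ∫ ω, X ω ^ 2 / K ∂P :=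
        setIntegral_le_integral hd (Eventually.of_forall fun ω => by positivity)
    _ ≤ C / K := by
        rw [integral_div]
        gcongr

lemma nonpos_of_forall_le_div {x C : ℝ} (h : ∀ K : ℝ, 0 < K → x ≤ C / K) : x ≤ 0 := by
  have : Tendsto (fun K : ℝ => C / K) atTop (𝓝 0) := tendsto_id.const_div_atTop C
  exact ge_of_tendsto this ((eventually_gt_atTop 0).mono h)

/-- Fatou's lemma applied to the squares. -/
lemma memLp_two_of_tendsto {X : ℕ → Ω → ℝ} {Y : Ω → ℝ} {C : ℝ} (hX : ∀ n, MemLp (X n) 2 P)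
    (hC : ∀ n, ∫ ω, X n ω ^ 2 ∂P ≤ C)
    (hlim : ∀ᵐ ω ∂P, Tendsto (fun n => X n ω) atTop (𝓝 (Y ω))) :
    MemLp Y 2 P ∧ ∫ ω, Y ω ^ 2 ∂P ≤ C := by
  have hY : AEStronglyMeasurable Y P :=
    aestronglyMeasurable_of_tendsto_ae _ (fun n => (hX n).1) hlim
  have hC0 : 0 ≤ C := (integral_nonneg fun ω => sq_nonneg _).trans (hC 0)
  have hb : ∫⁻ ω, ENNReal.ofReal (Y ω ^ 2) ∂P ≤ ENNReal.ofReal C := by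
    calc ∫⁻ ω, ENNReal.ofReal (Y ω ^ 2) ∂P
        = ∫⁻ ω, liminf (fun n => ENNReal.ofReal (X n ω ^ 2)) atTop ∂P := by
          refine lintegral_congr_ae (hlim.mono fun ω h => ?_)
          exact (((ENNReal.continuous_ofReal.tendsto _).comp (h.pow 2)).liminf_eq).symm
      _ ≤ liminf (fun n => ∫⁻ ω, ENNReal.ofReal (X n ω ^ 2) ∂P) atTop :=
          lintegral_liminf_le' fun n => ((hX n).1.aemeasurable.pow_const 2).ennreal_ofReal
      _ ≤ ENNReal.ofReal C := by
          refine liminf_le_of_le (by isBoundedDefault) fun x hx => ?_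
          obtain ⟨n, hn⟩ := hx.exists
          refine hn.trans ?_
          rw [← ofReal_integral_eq_lintegral_ofReal (hX n).integrable_sq
            (Eventually.of_forall fun ω => sq_nonneg _)]
          exact ENNReal.ofReal_le_ofReal (hC n)
  have hsq : Integrable (fun ω => Y ω ^ 2) P := by
    refine ⟨hY.pow 2, ?_⟩
    rw [hasFiniteIntegral_iff_ofReal (Eventually.of_forall fun ω => sq_nonneg _)]
    exact hb.trans_lt ENNReal.ofReal_lt_top
  refine ⟨(memLp_two_iff_integrable_sq hY).2 hsq, ?_⟩
  rw [integral_eq_lintegral_of_nonneg_ae (Eventually.of_forall fun ω => sq_nonneg _) (hY.pow 2)]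
  exact ENNReal.toReal_le_of_le_ofReal hC0 hb

/-- An `L²` bound gives uniform integrability: truncate at `K`, pass to the limit by dominated
convergence, and pay `C / K` both for the sequence and for its limit. -/
lemma setIntegral_eq_zero_of_tendsto [IsProbabilityMeasure P] {X : ℕ → Ω → ℝ} {Y : Ω → ℝ} {C : ℝ}
    (hX : ∀ n, MemLp (X n) 2 P) (hC : ∀ n, ∫ ω, X n ω ^ 2 ∂P ≤ C)
    (hlim : ∀ᵐ ω ∂P, Tendsto (fun n => X n ω) atTop (𝓝 (Y ω))) {A : Set Ω}
    (hA : ∀ n, ∫ ω in A, X n ω ∂P = 0) : ∫ ω in A, Y ω ∂P = 0 := by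
  obtain ⟨hY, hYC⟩ := memLp_two_of_tendsto hX hC hlim
  rw [← abs_nonpos_iff]
  refine nonpos_of_forall_le_div (C := 2 * C) fun K hK => ?_
  have h1 : Tendsto (fun n => ∫ ω in A, trunc K (X n ω) ∂P) atTop
      (𝓝 (∫ ω in A, trunc K (Y ω) ∂P)) := by
    refine tendsto_integral_of_dominated_convergence (fun _ => K)
      (fun n => (integrable_trunc hK.le (hX n).1).1.restrict) (integrable_const K)
      (fun n => Eventually.of_forall fun ω => abs_trunc_le hK.le _) (ae_restrict_of_ae ?_)
    exact hlim.mono fun ω h => ((continuous_trunc K).tendsto _).comp h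
  have h2 : |∫ ω in A, trunc K (Y ω) ∂P| ≤ C / K := by
    refine le_of_tendsto h1.abs (Eventually.of_forall fun n => ?_)
    simpa [hA n] using abs_setIntegral_trunc_sub_le hK (hX n) (hC n) A
  have h3 := abs_setIntegral_trunc_sub_le hK hY hYC A
  rw [mul_div_assoc, two_mul]
  grind

/-- A one-sided Fatou argument: the `X n` need not converge, it is enough that they asymptotically
dominate the bounded `D`. The truncated `min (X n) D` converges to `D`, while its mean is at most
the truncation error of a centred variable. -/
lemma integral_nonpos_of_eventually_le [IsProbabilityMeasure P] {X : ℕ → Ω → ℝ} {D : Ω → ℝ}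
    {C K₀ : ℝ}
    (hX : ∀ n, MemLp (X n) 2 P) (hC : ∀ n, ∫ ω, X n ω ^ 2 ∂P ≤ C)
    (h0 : ∀ n, ∫ ω, X n ω ∂P = 0) (hD : AEStronglyMeasurable D P) (hDb : ∀ ω, |D ω| ≤ K₀)
    (hle : ∀ᵐ ω ∂P, ∀ ε, 0 < ε → ∀ᶠ n in atTop, D ω - ε ≤ X n ω) : ∫ ω, D ω ∂P ≤ 0 := by
  have hC0 : 0 ≤ C := (integral_nonneg fun ω => sq_nonneg _).trans (hC 0)
  have hK0 : 0 ≤ K₀ := by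
    obtain ⟨ω⟩ : Nonempty Ω := nonempty_of_isProbabilityMeasure P
    exact (abs_nonneg _).trans (hDb ω)
  refine nonpos_of_forall_le_div (C := C) fun K' hK' => ?_
  -- A level at least `K₀` keeps the truncation from cutting below `D`; the part `K'` is free to
  -- tend to infinity.
  set K := K' + K₀ with hKdef
  have hK : 0 < K := by positivity
  have hm (n : ℕ) : AEStronglyMeasurable (fun ω => min (trunc K (X n ω)) (D ω)) P :=
    (integrable_trunc hK.le (hX n).1).1.inf hD
  have hb (n : ℕ) (ω : Ω) : |min (trunc K (X n ω)) (D ω)| ≤ K := by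
    have := abs_trunc_le hK.le (X n ω)
    have := hDb ω
    grind
  have h1 : Tendsto (fun n => ∫ ω, min (trunc K (X n ω)) (D ω) ∂P) atTop (𝓝 (∫ ω, D ω ∂P)) := by
    refine tendsto_integral_of_dominated_convergence (fun _ => K) hm (integrable_const K)
      (fun n => Eventually.of_forall (hb n)) ?_
    filter_upwards [hle] with ω h
    rw [Metric.tendsto_atTop']
    intro ε hε
    obtain ⟨N, hN⟩ := eventually_atTop.1 (h (ε / 2) (half_pos hε))
    refine ⟨N, fun n hn => ?_⟩
    have h2 := hN n hn.le
    have h3 := hDb ω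
    rw [Real.dist_eq]
    unfold trunc
    grind
  refine le_of_tendsto h1 (Eventually.of_forall fun n => ?_)
  have h2 := abs_setIntegral_trunc_sub_le hK (hX n) (hC n) Set.univ
  simp only [Measure.restrict_univ, h0 n, sub_zero] at h2
  calc ∫ ω, min (trunc K (X n ω)) (D ω) ∂P ≤ ∫ ω, trunc K (X n ω) ∂P :=
        integral_mono (Integrable.of_bound (hm n) K (Eventually.of_forall (hb n)))
          (integrable_trunc hK.le (hX n).1) fun ω => min_le_left _ _
    _ ≤ C / K := (le_abs_self _).trans h2
    _ ≤ C / K' := by gcongr; linarith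

end SecondMoment

/-! ### Discrete stochastic integrals -/

section Discrete

variable {Ω : Type*} {mΩ : MeasurableSpace Ω} {P : Measure Ω} {ℱ : Filtration ℝ≥0 mΩ}
  {W : ℝ≥0 → Ω → ℝ}

/-! ### Brownian increments multiplied by past factors -/

namespace IsFilteredBrownian

lemma hasLaw_increment (hW : IsFilteredBrownian P ℱ W) {s t : ℝ≥0} :
    HasLaw (fun ω => W t ω - W s ω) (gaussianReal 0 (nndist t.1 s.1)) P :=
  hW.isBrownian.toIsPreBrownianReal.hasLaw_sub t s

lemma measurable_increment (hW : IsFilteredBrownian P ℱ W) (s t : ℝ≥0) :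
    Measurable fun ω => W t ω - W s ω :=
  ((hW.adapted t).mono (ℱ.le t) le_rfl).sub ((hW.adapted s).mono (ℱ.le s) le_rfl)

lemma memLp_increment (hW : IsFilteredBrownian P ℱ W) (s t : ℝ≥0) :
    MemLp (fun ω => W t ω - W s ω) 2 P :=
  (hW.hasLaw_increment).hasGaussianLaw.memLp_two

lemma integral_increment (hW : IsFilteredBrownian P ℱ W) (s t : ℝ≥0) :
    ∫ ω, (W t ω - W s ω) ∂P = 0 := by
  rw [hW.hasLaw_increment.integral_eq, integral_id_gaussianReal]

lemma integral_increment_sq [IsProbabilityMeasure P] (hW : IsFilteredBrownian P ℱ W) {s t : ℝ≥0}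
    (hst : s ≤ t) : ∫ ω, (W t ω - W s ω) ^ 2 ∂P = t - s := by
  have h1 := hW.hasLaw_increment (s := s) (t := t) |>.variance_eq
  rw [variance_id_gaussianReal, variance_eq_sub (hW.memLp_increment s t),
    hW.integral_increment s t] at h1
  simp only [Pi.pow_apply, coe_nndist] at h1
  have h2 : dist t.1 s.1 = (t : ℝ) - s :=
    abs_of_nonneg (sub_nonneg.2 (NNReal.coe_le_coe.2 hst))
  simpa using h1.trans h2

lemma indepFun_increment (hW : IsFilteredBrownian P ℱ W) {s t : ℝ≥0} (hst : s ≤ t) {X : Ω → ℝ}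
    (hX : Measurable[ℱ s] X) : IndepFun X (fun ω => W t ω - W s ω) P :=
  (indep_of_indep_of_le_right (hW.indep s t hst) hX.comap_le).symm

/-- Independence factorises the integral, and the increment is centred. Integrability of `X` is not
required, as the factorisation asks only for measurability. -/
lemma integral_mul_increment (hW : IsFilteredBrownian P ℱ W) {s t : ℝ≥0} (hst : s ≤ t) {X : Ω → ℝ}
    (hX : Measurable[ℱ s] X) : ∫ ω, X ω * (W t ω - W s ω) ∂P = 0 := by
  rw [(hW.indepFun_increment hst hX).integral_fun_mul_eq_mul_integral
    (hX.mono (ℱ.le s) le_rfl).aestronglyMeasurable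
    (hW.measurable_increment s t).aestronglyMeasurable, hW.integral_increment s t, mul_zero]

lemma indepFun_sq_increment (hW : IsFilteredBrownian P ℱ W) {s t : ℝ≥0} (hst : s ≤ t) {X : Ω → ℝ}
    (hX : Measurable[ℱ s] X) :
    IndepFun (fun ω => X ω ^ 2) (fun ω => (W t ω - W s ω) ^ 2) P :=
  (hW.indepFun_increment hst hX).comp (φ := fun x => x ^ 2) (ψ := fun x => x ^ 2)
    (by fun_prop) (by fun_prop)

lemma integral_sq_mul_increment [IsProbabilityMeasure P] (hW : IsFilteredBrownian P ℱ W)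
    {s t : ℝ≥0} (hst : s ≤ t) {X : Ω → ℝ} (hX : Measurable[ℱ s] X) :
    ∫ ω, (X ω * (W t ω - W s ω)) ^ 2 ∂P = (∫ ω, X ω ^ 2 ∂P) * (t - s) := by
  simp_rw [mul_pow]
  rw [(hW.indepFun_sq_increment hst hX).integral_fun_mul_eq_mul_integral
    ((hX.mono (ℱ.le s) le_rfl).pow_const 2).aestronglyMeasurable
    ((hW.measurable_increment s t).pow_const 2).aestronglyMeasurable, hW.integral_increment_sq hst]

lemma memLp_mul_increment [IsProbabilityMeasure P] (hW : IsFilteredBrownian P ℱ W)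
    {s t : ℝ≥0} (hst : s ≤ t) {X : Ω → ℝ} (hX : Measurable[ℱ s] X) (hX2 : MemLp X 2 P) :
    MemLp (fun ω => X ω * (W t ω - W s ω)) 2 P := by
  have hm : Measurable fun ω => X ω * (W t ω - W s ω) :=
    (hX.mono (ℱ.le s) le_rfl).mul (hW.measurable_increment s t)
  rw [memLp_two_iff_integrable_sq hm.aestronglyMeasurable]
  simp_rw [mul_pow]
  exact (hW.indepFun_sq_increment hst hX).integrable_mul hX2.integrable_sq
    (hW.memLp_increment s t).integrable_sq

end IsFilteredBrownian

/-- The discrete stochastic integral of the sequence `ξ` along `π`. -/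
def discreteIntegral (ξ : ℕ → Ω → ℝ) (W : ℝ≥0 → Ω → ℝ) (π : ℕ → ℝ≥0) (N : ℕ) (ω : Ω) : ℝ :=
  ∑ k ∈ Finset.range N, ξ k ω * (W (π (k + 1)) ω - W (π k) ω)

lemma discreteIntegral_succ (ξ : ℕ → Ω → ℝ) (W : ℝ≥0 → Ω → ℝ) (π : ℕ → ℝ≥0) (N : ℕ) (ω : Ω) :
    discreteIntegral ξ W π (N + 1) ω = discreteIntegral ξ W π N ω +
      ξ N ω * (W (π (N + 1)) ω - W (π N) ω) := Finset.sum_range_succ _ _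

variable {ξ : ℕ → Ω → ℝ} {π : ℕ → ℝ≥0}

lemma measurable_discreteIntegral (hW : IsFilteredBrownian P ℱ W) (hπ : Monotone π)
    (hξ : ∀ k, Measurable[ℱ (π k)] (ξ k)) (N : ℕ) :
    Measurable[ℱ (π N)] (discreteIntegral ξ W π N) := by
  induction N with
  | zero =>
    have : discreteIntegral ξ W π 0 = fun _ => 0 := by ext; simp [discreteIntegral]
    rw [this]
    exact measurable_const
  | succ N ih =>
    have : discreteIntegral ξ W π (N + 1) = fun ω => discreteIntegral ξ W π N ω +
      ξ N ω * (W (π (N + 1)) ω - W (π N) ω) := funext fun ω => discreteIntegral_succ ..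
    rw [this]
    have hle := ℱ.mono (hπ N.le_succ)
    exact (ih.mono hle le_rfl).add (((hξ N).mono hle le_rfl).mul
      ((hW.adapted _).sub ((hW.adapted _).mono hle le_rfl)))

variable [IsProbabilityMeasure P]

/-- The discrete Itô isometry: in expanding the square, the cross term is a past factor times the
new increment, hence centred. -/
lemma discreteIntegral_secondMoment (hW : IsFilteredBrownian P ℱ W) (hπ : Monotone π)
    (hξ : ∀ k, Measurable[ℱ (π k)] (ξ k)) (hξ2 : ∀ k, MemLp (ξ k) 2 P) (N : ℕ) :
    MemLp (discreteIntegral ξ W π N) 2 P ∧ ∫ ω, discreteIntegral ξ W π N ω ^ 2 ∂P =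
      ∑ k ∈ Finset.range N, (∫ ω, ξ k ω ^ 2 ∂P) * (π (k + 1) - π k) := by
  induction N with
  | zero =>
    have : discreteIntegral ξ W π 0 = fun _ => 0 := by ext; simp [discreteIntegral]
    simp [this]
  | succ N ih =>
    have heq : discreteIntegral ξ W π (N + 1) = fun ω => discreteIntegral ξ W π N ω +
      ξ N ω * (W (π (N + 1)) ω - W (π N) ω) := funext fun ω => discreteIntegral_succ ..
    have h2 := hW.memLp_mul_increment (hπ N.le_succ) (hξ N) (hξ2 N)
    rw [heq]
    refine ⟨ih.1.add h2, ?_⟩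
    have hcross : ∫ ω, 2 * discreteIntegral ξ W π N ω * (ξ N ω * (W (π (N + 1)) ω - W (π N) ω)) ∂P
        = 0 := by
      have := hW.integral_mul_increment (hπ N.le_succ)
        (((measurable_discreteIntegral hW hπ hξ N).const_mul 2).mul (hξ N))
      rw [← this]
      refine integral_congr_ae (Eventually.of_forall fun ω => ?_)
      simp [mul_assoc]
    have hci : Integrable (fun ω => 2 * discreteIntegral ξ W π N ω *
        (ξ N ω * (W (π (N + 1)) ω - W (π N) ω))) P := by
      simpa [mul_assoc] using (ih.1.integrable_mul h2).const_mul 2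
    rw [Finset.sum_range_succ, ← ih.2, ← hW.integral_sq_mul_increment (hπ N.le_succ) (hξ N)]
    simp_rw [add_sq]
    have h3 := integral_add (ih.1.integrable_sq.add hci) h2.integrable_sq
    have h4 := integral_add ih.1.integrable_sq hci
    rw [hcross, add_zero] at h4
    exact h3.trans (congrArg (· + _) h4)

/-- The martingale property: restricting to a past event replaces `ξ N` by its indicator multiple,
which is still a past factor of the increment. -/
lemma setIntegral_discreteIntegral (hW : IsFilteredBrownian P ℱ W) (hπ : Monotone π)
    (hξ : ∀ k, Measurable[ℱ (π k)] (ξ k)) (hξ2 : ∀ k, MemLp (ξ k) 2 P) {n N : ℕ} (hn : n ≤ N)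
    {A : Set Ω} (hA : MeasurableSet[ℱ (π n)] A) :
    ∫ ω in A, (discreteIntegral ξ W π N ω - discreteIntegral ξ W π n ω) ∂P = 0 := by
  induction N, hn using Nat.le_induction with
  | base => simp
  | succ N hnN ih =>
    have hA' := ℱ.mono (hπ hnN) A hA
    have hint (k : ℕ) := (discreteIntegral_secondMoment hW hπ hξ hξ2 k).1.integrable one_le_two
    have h2 := (hW.memLp_mul_increment (hπ N.le_succ) (hξ N) (hξ2 N)).integrable one_le_two
    simp_rw [discreteIntegral_succ, add_sub_right_comm]
    refine (integral_add ((hint N).sub (hint n)).integrableOn h2.integrableOn).trans ?_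
    refine (congrArg (· + _) ih).trans ?_
    rw [zero_add, ← integral_indicator (ℱ.le _ _ hA'),
      ← hW.integral_mul_increment (hπ N.le_succ) ((hξ N).indicator hA')]
    refine integral_congr_ae (Eventually.of_forall fun ω => ?_)
    by_cases h : ω ∈ A <;> simp [h]

lemma discreteIntegral_secondMoment_le (hW : IsFilteredBrownian P ℱ W) {s t : ℝ≥0} {δ : ℝ} {N : ℕ}
    (hπ : IsSubdivision s t δ N π) (hξ : ∀ k, Measurable[ℱ (π k)] (ξ k))
    (hξ2 : ∀ k, MemLp (ξ k) 2 P) {C : ℝ} (hC : ∀ k < N, ∫ ω, ξ k ω ^ 2 ∂P ≤ C) :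
    ∫ ω, discreteIntegral ξ W π N ω ^ 2 ∂P ≤ C * (t - s) := by
  rw [(discreteIntegral_secondMoment hW hπ.mono hξ hξ2 N).2]
  calc ∑ k ∈ Finset.range N, (∫ ω, ξ k ω ^ 2 ∂P) * ((π (k + 1) : ℝ) - π k)
      ≤ ∑ k ∈ Finset.range N, C * ((π (k + 1) : ℝ) - π k) := by
        refine Finset.sum_le_sum fun k hk => ?_
        exact mul_le_mul_of_nonneg_right (hC k (Finset.mem_range.1 hk))
          (sub_nonneg.2 (NNReal.coe_le_coe.2 (hπ.mono k.le_succ)))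
    _ = C * (t - s) := by
        rw [← Finset.mul_sum, Finset.sum_range_sub (fun k => (π k : ℝ)), hπ.left, hπ.right]

end Discrete

/-! ### Subdivisions -/

/-- The grid with `N` equal steps from `s₀` to `s` followed by `N` equal steps from `s` to `t`
(and continued beyond). -/
def splitGrid (s₀ s t : ℝ≥0) (N k : ℕ) : ℝ≥0 :=
  s₀ + (min k N : ℕ) / N * (s - s₀) + (k - N : ℕ) / N * (t - s)

lemma isSubdivision_splitGrid {s₀ s t : ℝ≥0} (hs : s₀ ≤ s) (ht : s ≤ t) {N : ℕ} (hN : 0 < N)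
    {δ : ℝ} (hδ : (t - s₀ : ℝ) / N ≤ δ) : IsSubdivision s₀ t δ (2 * N) (splitGrid s₀ s t N) where
  mono k l hkl := by
    unfold splitGrid
    gcongr
  left := by simp [splitGrid]
  right := by
    have h1 : min (2 * N) N = N := by omega
    have h2 : 2 * N - N = N := by omega
    have h3 : (N : ℝ≥0) ≠ 0 := by positivity
    simp only [splitGrid, h1, h2]
    rw [div_self h3, one_mul, one_mul, add_tsub_cancel_of_le hs, add_tsub_cancel_of_le ht]
  mesh k _ := by
    refine le_trans ?_ hδ
    have hs' : (0 : ℝ) ≤ s - s₀ := sub_nonneg.2 (NNReal.coe_le_coe.2 hs)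
    have ht' : (0 : ℝ) ≤ t - s := sub_nonneg.2 (NNReal.coe_le_coe.2 ht)
    have hN' : (0 : ℝ) < N := by positivity
    have h1 : ((min (k + 1) N : ℕ) : ℝ) ≤ (min k N : ℕ) + 1 := by exact_mod_cast (by omega)
    have h2 : ((k + 1 - N : ℕ) : ℝ) ≤ (k - N : ℕ) + 1 := by exact_mod_cast (by omega)
    simp only [splitGrid, NNReal.coe_add, NNReal.coe_mul, NNReal.coe_div, NNReal.coe_natCast,
      NNReal.coe_sub hs, NNReal.coe_sub ht]
    rw [sub_le_iff_le_add]
    -- Each counter grows by at most one, so the sum of the two step lengths, `(t - s₀) / N`, bounds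
    -- the mesh.
    calc (s₀ : ℝ) + (min (k + 1) N : ℕ) / N * (s - s₀) + (k + 1 - N : ℕ) / N * (t - s)
        ≤ s₀ + ((min k N : ℕ) + 1) / N * (s - s₀) + ((k - N : ℕ) + 1) / N * (t - s) := by gcongr
      _ = _ := by field_simp; ring

lemma splitGrid_self {s₀ s t : ℝ≥0} (hs : s₀ ≤ s) {N : ℕ} (hN : 0 < N) :
    splitGrid s₀ s t N N = s := by
  have h3 : (N : ℝ≥0) ≠ 0 := by positivity
  simp only [splitGrid, min_self, Nat.sub_self]
  rw [div_self h3, one_mul, add_tsub_cancel_of_le hs]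
  simp

/-- The intermediate time `s` has to be a grid point, so that the increment of the integral after
`s` is a sum over later steps. -/
lemma exists_isSubdivision {s₀ s t : ℝ≥0} (hs : s₀ ≤ s) (ht : s ≤ t) {δ : ℝ} (hδ : 0 < δ) :
    ∃ (N n : ℕ) (π : ℕ → ℝ≥0), IsSubdivision s₀ t δ N π ∧ n ≤ N ∧ π n = s := by
  obtain ⟨N, hN⟩ := exists_nat_gt ((t - s₀ : ℝ) / δ)
  have hst : (0 : ℝ) ≤ t - s₀ := sub_nonneg.2 (NNReal.coe_le_coe.2 (hs.trans ht))
  have hN0 : (0 : ℝ) < N := lt_of_le_of_lt (by positivity) hN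
  have hN' : 0 < N := by exact_mod_cast hN0
  refine ⟨2 * N, N, splitGrid s₀ s t N, isSubdivision_splitGrid hs ht hN' ?_, by omega,
    splitGrid_self hs hN'⟩
  rw [div_lt_iff₀ hδ] at hN
  rw [div_le_iff₀ hN0]
  linarith

lemma IsSubdivision.mono_mesh {s t : ℝ≥0} {δ δ' : ℝ} {N : ℕ} {π : ℕ → ℝ≥0}
    (h : IsSubdivision s t δ N π) (hδ : δ ≤ δ') : IsSubdivision s t δ' N π :=
  ⟨h.mono, h.left, h.right, fun k hk => (h.mesh k hk).trans hδ⟩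

/-- Every point of the interval is followed by a point of the subdivision within the mesh. -/
lemma IsSubdivision.exists_near {s t : ℝ≥0} {δ : ℝ} {N : ℕ} {π : ℕ → ℝ≥0}
    (h : IsSubdivision s t δ N π) (hδ : 0 ≤ δ) {q : ℝ} (hs : s ≤ q) (ht : q ≤ t) :
    ∃ k ≤ N, q ≤ π k ∧ π k ≤ q + δ := by
  classical
  have hex : ∃ k, q ≤ π k := ⟨N, h.right ▸ ht⟩
  set k := Nat.find hex
  have hk : q ≤ π k := Nat.find_spec hex
  have hkN : k ≤ N := Nat.find_min' hex (h.right ▸ ht)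
  refine ⟨k, hkN, hk, ?_⟩
  rcases Nat.eq_zero_or_pos k with h0 | h0
  · rw [h0, h.left]
    linarith
  · have h1 := h.mesh (k - 1) (by omega)
    have h2 : ¬ q ≤ π (k - 1) := Nat.find_min hex (by omega)
    rw [Nat.sub_add_cancel h0] at h1
    linarith

/-- Along suitable subdivisions, elementary integrals converge almost surely and uniformly. -/
lemma IsItoIntegral.exists_subdivisions {Ω : Type*} {mΩ : MeasurableSpace Ω} {P : Measure Ω}
    {H W I : ℝ≥0 → Ω → ℝ} {s₀ s t : ℝ≥0} (hI : IsItoIntegral P H W s₀ I) (hs : s₀ ≤ s)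
    (ht : s ≤ t) :
    ∃ (N n : ℕ → ℕ) (π : ℕ → ℕ → ℝ≥0),
      (∀ j : ℕ, IsSubdivision s₀ t (1 / ((j : ℝ) + 1)) (N j) (π j)) ∧ (∀ j, n j ≤ N j) ∧
      (∀ j, π j (n j) = s) ∧ ∀ᵐ ω ∂P, ∀ ε : ℝ, 0 < ε → ∀ᶠ j in atTop, ∀ u, s₀ ≤ u → u ≤ t →
        |elemIntegral H W (N j) (π j) u ω - I u ω| < ε := by
  have h (j : ℕ) : ∃ (N n : ℕ) (π : ℕ → ℝ≥0), IsSubdivision s₀ t (1 / (j + 1)) N π ∧ n ≤ N ∧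
      π n = s ∧ P {ω | ∃ u, s₀ ≤ u ∧ u ≤ t ∧ 1 / ((j : ℝ) + 1) ≤ |elemIntegral H W N π u ω - I u ω|}
        ≤ ENNReal.ofReal ((1 / 2) ^ j) := by
    obtain ⟨δ, hδ, hδ'⟩ := hI t (hs.trans ht) (1 / (j + 1)) (by positivity) ((1 / 2) ^ j)
      (by positivity)
    obtain ⟨N, n, π, h1, h2, h3⟩ := exists_isSubdivision hs ht
      (show 0 < min δ (1 / ((j : ℝ) + 1)) by positivity)
    exact ⟨N, n, π, h1.mono_mesh (min_le_right _ _), h2, h3,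
      hδ' N π (h1.mono_mesh (min_le_left _ _))⟩
  choose N n π h1 h2 h3 h4 using h
  refine ⟨N, n, π, h1, h2, h3, ?_⟩
  -- Borel–Cantelli: the exceptional events were chosen with probabilities at most `2⁻ʲ`.
  have hsum : ∑' j : ℕ, P {ω | ∃ u, s₀ ≤ u ∧ u ≤ t ∧
      1 / ((j : ℝ) + 1) ≤ |elemIntegral H W (N j) (π j) u ω - I u ω|} ≠ ∞ := by
    refine ne_top_of_le_ne_top ?_ (ENNReal.tsum_le_tsum h4)
    rw [← ENNReal.ofReal_tsum_of_nonneg (fun j => by positivity) summable_geometric_two]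
    exact ENNReal.ofReal_ne_top
  filter_upwards [ae_eventually_notMem hsum] with ω hω ε hε
  have h5 : ∀ᶠ j : ℕ in atTop, 1 / ((j : ℝ) + 1) < ε :=
    tendsto_one_div_add_atTop_nhds_zero_nat.eventually (gt_mem_nhds hε)
  filter_upwards [hω, h5] with j hj hj' u hu hu'
  by_contra hcon
  exact hj ⟨u, hu, hu', hj'.le.trans (not_lt.1 hcon)⟩

lemma elemIntegral_eq_discreteIntegral {Ω : Type*} (H W : ℝ≥0 → Ω → ℝ) {π : ℕ → ℝ≥0}
    (hπ : Monotone π) {n N : ℕ} (hn : n ≤ N) (ω : Ω) :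
    elemIntegral H W N π (π n) ω = discreteIntegral (fun k => H (π k)) W π n ω := by
  unfold elemIntegral discreteIntegral
  rw [← Finset.sum_subset (Finset.range_mono hn)]
  · refine Finset.sum_congr rfl fun k hk => ?_
    have hk := Finset.mem_range.1 hk
    rw [min_eq_left (hπ hk), min_eq_left (hπ hk.le)]
  · intro k _ hk
    have hk : n ≤ k := by simpa using hk
    rw [min_eq_right (hπ (hk.trans k.le_succ)), min_eq_right (hπ hk), sub_self, mul_zero]

open Classical in
/-- The integrand `H` along the grid `π`, put to `0` once `V` has exceeded `m` on the grid. -/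
def stoppedIntegrand {Ω : Type*} (V H : ℝ≥0 → Ω → ℝ) (π : ℕ → ℝ≥0) (m : ℝ) (k : ℕ) (ω : Ω) : ℝ :=
  if ∀ j ≤ k, V (π j) ω ≤ m then H (π k) ω else 0

/-- The integral of the stopped integrand is the elementary integral up to the first grid point at
which `V` exceeds `m`. -/
lemma exists_elemIntegral_eq {Ω : Type*} (V H W : ℝ≥0 → Ω → ℝ) {s t : ℝ≥0} {δ : ℝ} {N : ℕ}
    {π : ℕ → ℝ≥0} (h : IsSubdivision s t δ N π) (m : ℝ) (ω : Ω) :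
    ∃ τ, s ≤ τ ∧ τ ≤ t ∧ ((∀ k ≤ N, V (π k) ω ≤ m) → τ = t) ∧
      (∀ k ≤ N, m < V (π k) ω → τ ≤ π k) ∧
      elemIntegral H W N π τ ω = discreteIntegral (stoppedIntegrand V H π m) W π N ω := by
  classical
  by_cases hex : ∃ k, k ≤ N ∧ m < V (π k) ω
  · set κ := Nat.find hex
    obtain ⟨hκ1, hκ2⟩ : κ ≤ N ∧ m < V (π κ) ω := Nat.find_spec hex
    refine ⟨π κ, h.left ▸ h.mono (Nat.zero_le _), h.right ▸ h.mono hκ1,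
      fun hk => absurd (hk κ hκ1) (not_le.2 hκ2),
      fun k hk hkm => h.mono (Nat.find_min' hex ⟨hk, hkm⟩), ?_⟩
    unfold elemIntegral discreteIntegral
    refine Finset.sum_congr rfl fun k hk => ?_
    have hk := Finset.mem_range.1 hk
    by_cases hkκ : k < κ
    · have hall : ∀ j ≤ k, V (π j) ω ≤ m := fun j hj => not_lt.1 fun hlt =>
        Nat.find_min hex (lt_of_le_of_lt hj hkκ) ⟨hj.trans hk.le, hlt⟩
      rw [min_eq_left (h.mono hkκ), min_eq_left (h.mono hkκ.le), stoppedIntegrand, if_pos hall]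
    · have hκk : κ ≤ k := not_lt.1 hkκ
      rw [min_eq_right (h.mono (hκk.trans k.le_succ)), min_eq_right (h.mono hκk), stoppedIntegrand,
        if_neg fun hall => not_lt.2 (hall κ hκk) hκ2]
      simp
  · push Not at hex
    refine ⟨t, ?_, le_rfl, fun _ => rfl, fun k hk hkm => absurd (hex k hk) (not_le.2 hkm), ?_⟩
    · rw [← h.left, ← h.right]
      exact h.mono (Nat.zero_le _)
    · have h1 := elemIntegral_eq_discreteIntegral H W h.mono (le_refl N) ω
      rw [h.right] at h1
      rw [h1]
      unfold discreteIntegral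
      refine Finset.sum_congr rfl fun k hk => ?_
      rw [stoppedIntegrand, if_pos fun j hj => hex j (hj.trans (Finset.mem_range.1 hk).le)]

/-! ### Deterministic estimates -/

open Classical in
/-- The value `y r`, put to `0` once `y` has exceeded `m` on `[s, r]`. -/
def killed (y : ℝ → ℝ) (s m r : ℝ) : ℝ := if ∀ q, s ≤ q → q ≤ r → y q ≤ m then y r else 0

section Killed

variable {y : ℝ → ℝ} {s t m : ℝ}

lemma killed_nonneg (h0 : ∀ r, 0 ≤ y r) (r : ℝ) : 0 ≤ killed y s m r := by
  unfold killed
  split_ifs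
  exacts [h0 r, le_rfl]

lemma killed_le_self (h0 : ∀ r, 0 ≤ y r) (r : ℝ) : killed y s m r ≤ y r := by
  unfold killed
  split_ifs
  exacts [le_rfl, h0 r]

lemma killed_le (hm : 0 ≤ m) {r : ℝ} (hr : s ≤ r) : killed y s m r ≤ m := by
  unfold killed
  split_ifs with h
  exacts [h r hr le_rfl, hm]

lemma intervalIntegrable_killed (hy : Continuous y) (h0 : ∀ r, 0 ≤ y r) (u v : ℝ) :
    IntervalIntegrable (killed y s m) volume u v := by
  have hS : MeasurableSet {r | ∀ q, s ≤ q → q ≤ r → y q ≤ m} := by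
    refine Set.OrdConnected.measurableSet ⟨fun r₁ _ r₂ h2 r hr q hq hqr => ?_⟩
    exact h2 q hq (hqr.trans hr.2)
  refine (hy.intervalIntegrable u v).mono_fun ?_ (Eventually.of_forall fun r => ?_)
  · exact (Measurable.ite hS hy.measurable measurable_const).aestronglyMeasurable
  · simp only [Real.norm_of_nonneg (killed_nonneg h0 r), Real.norm_of_nonneg (h0 r)]
    exact killed_le_self h0 r

/-- Let `r₀` be the infimum of the times at which `y` exceeds `m`. Up to `r₀` the killed path agrees
with `y`, and the `τ j` eventually overshoot `r₀` by arbitrarily little, which costs at most `ε` by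
continuity of the primitive. -/
lemma eventually_integral_le_killed (hy : Continuous y) (h0 : ∀ r, 0 ≤ y r)
    {τ : ℕ → ℝ} (hτ : ∀ j, s ≤ τ j ∧ τ j ≤ t)
    (h2 : ∀ q, s ≤ q → q ≤ t → m < y q → ∀ ε, 0 < ε → ∀ᶠ j in atTop, τ j ≤ q + ε)
    {ε : ℝ} (hε : 0 < ε) :
    ∀ᶠ j in atTop, ∫ r in s..τ j, y r ≤ (∫ r in s..t, killed y s m r) + ε := by
  have hst : s ≤ t := (hτ 0).1.trans (hτ 0).2
  have hmono {u v : ℝ} (hu : s ≤ u) (huv : u ≤ v) : ∫ r in s..u, y r ≤ ∫ r in s..v, y r :=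
    intervalIntegral.integral_mono_interval le_rfl hu huv (Eventually.of_forall h0)
      (hy.intervalIntegrable _ _)
  have hkill {u : ℝ} (hu : s ≤ u) (hut : u ≤ t) (hle : ∀ r, s ≤ r → r < u → y r ≤ m) :
      ∫ r in s..u, y r ≤ ∫ r in s..t, killed y s m r := by
    calc ∫ r in s..u, y r = ∫ r in s..u, killed y s m r := by
          -- The endpoint is dropped because the bound by `m` is only known strictly before `u`.
          rw [intervalIntegral.integral_of_le hu, intervalIntegral.integral_of_le hu,
            integral_Ioc_eq_integral_Ioo, integral_Ioc_eq_integral_Ioo]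
          refine setIntegral_congr_fun measurableSet_Ioo fun r hr => ?_
          rw [killed, if_pos fun q hq hqr => hle q hq (hqr.trans_lt hr.2)]
      _ ≤ ∫ r in s..t, killed y s m r :=
          intervalIntegral.integral_mono_interval le_rfl hu hut
            (Eventually.of_forall (killed_nonneg h0)) (intervalIntegrable_killed hy h0 _ _)
  by_cases hJ : ∀ q, s ≤ q → q ≤ t → y q ≤ m
  · refine Eventually.of_forall fun j => ?_
    have := hkill hst le_rfl fun r hr hrt => hJ r hr hrt.le
    have := hmono (hτ j).1 (hτ j).2
    linarith
  · push Not at hJ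
    set S := {q | s ≤ q ∧ q ≤ t ∧ m < y q} with hS
    have hSne : S.Nonempty := let ⟨q, h1, h2, h3⟩ := hJ; ⟨q, h1, h2, h3⟩
    have hSb : BddBelow S := ⟨s, fun q hq => hq.1⟩
    set r₀ := sInf S
    have hr₀ : s ≤ r₀ := le_csInf hSne fun q hq => hq.1
    have hr₀t : r₀ ≤ t := let ⟨q, hq⟩ := hSne; (csInf_le hSb hq).trans hq.2.1
    have hcont : Continuous fun u => ∫ r in s..u, y r :=
      intervalIntegral.continuous_primitive (fun _ _ => hy.intervalIntegrable _ _) s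
    obtain ⟨η, hη, hη'⟩ := Metric.continuous_iff.1 hcont r₀ ε hε
    -- The infimum itself may not be a time of excess, so a nearby `q` is used; the margins `η / 2`
    -- and `η / 4` add up to less than `η`.
    obtain ⟨q, hq, hqr⟩ := exists_lt_of_csInf_lt hSne (show sInf S < r₀ + η / 2 by simp [r₀, hη])
    have hmax := hkill hr₀ hr₀t fun r hr hrr => by
      by_contra hcon
      exact absurd (csInf_le hSb ⟨hr, hrr.le.trans hr₀t, not_le.1 hcon⟩) (not_le.2 hrr)
    filter_upwards [h2 q hq.1 hq.2.1 hq.2.2 (η / 4) (by positivity)] with j hj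
    have h3 := hmono (hτ j).1 (le_max_left (τ j) r₀)
    have h4 := hη' (max (τ j) r₀) (by
      rw [Real.dist_eq, abs_of_nonneg (by simp)]
      rcases max_cases (τ j) r₀ with h | h <;> linarith)
    rw [Real.dist_eq] at h4
    have := (abs_lt.1 h4).2
    linarith

/-- If `y` stays below `m`, then `τ j = t` and the killed value is `y t`; otherwise the killed value
is `0 ≤ y (τ j)`. The drift is bounded above through `|b|`, so only an upper bound on the integral
up to `τ j` is needed. -/
lemma eventually_killed_sub_le (hy : Continuous y) (h0 : ∀ r, 0 ≤ y r) {a b x : ℝ} (ha : 0 ≤ a)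
    {τ : ℕ → ℝ} (hτ : ∀ j, s ≤ τ j ∧ τ j ≤ t)
    (h1 : (∀ q, s ≤ q → q ≤ t → y q ≤ m) → ∀ j, τ j = t)
    (h2 : ∀ q, s ≤ q → q ≤ t → m < y q → ∀ ε, 0 < ε → ∀ᶠ j in atTop, τ j ≤ q + ε)
    {ε : ℝ} (hε : 0 < ε) :
    ∀ᶠ j in atTop,
      killed y s m t - (x + a * (t - s) + |b| * ∫ r in s..t, killed y s m r) - ε ≤
        y (τ j) - x - ∫ r in s..τ j, (a + b * y r) := by
  have hε' : 0 < ε / (|b| + 1) := by positivity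
  filter_upwards [eventually_integral_le_killed hy h0 hτ h2 hε'] with j hj
  have h3 : killed y s m t ≤ y (τ j) := by
    unfold killed
    split_ifs with h
    · rw [h1 h j]
    · exact h0 _
  have h4 : ∫ r in s..τ j, (a + b * y r) = a * (τ j - s) + b * ∫ r in s..τ j, y r := by
    rw [intervalIntegral.integral_add (by simp) ((hy.intervalIntegrable _ _).const_mul b)]
    simp [mul_comm]
  have h5 : 0 ≤ ∫ r in s..τ j, y r := intervalIntegral.integral_nonneg (hτ j).1 fun r _ => h0 r
  have h6 : b * ∫ r in s..τ j, y r ≤ |b| * ∫ r in s..τ j, y r :=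
    mul_le_mul_of_nonneg_right (le_abs_self b) h5
  have h7 : |b| * ∫ r in s..τ j, y r ≤ |b| * ((∫ r in s..t, killed y s m r) + ε / (|b| + 1)) :=
    mul_le_mul_of_nonneg_left hj (abs_nonneg b)
  have h8 : |b| * (ε / (|b| + 1)) ≤ ε := by
    rw [mul_div_assoc', div_le_iff₀ (by positivity)]
    nlinarith [abs_nonneg b]
  have h9 : a * (τ j - s) ≤ a * (t - s) := by
    have := (hτ j).2
    gcongr
  rw [h4]
  linarith

end Killed

/-- A Gronwall inequality for a bounded function which need not be continuous. -/
lemma le_of_le_add_mul_integral {g : ℝ → ℝ} {s t m K B : ℝ} (hK : 0 ≤ K) (hB : 0 < B)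
    (hm : ∀ r ∈ Set.Icc s t, g r ≤ m) (hint : ∀ r ∈ Set.Icc s t, IntervalIntegrable g volume s r)
    (hg : ∀ r ∈ Set.Icc s t, g r ≤ K + B * ∫ q in s..r, g q) :
    ∀ r ∈ Set.Icc s t, g r ≤ 2 * K * Real.exp (2 * B * (r - s)) := by
  -- The rate `2 * B` makes each substitution of the bound into the inequality halve the
  -- contribution of `|m|`, leaving `2 * K` in the limit.
  have hn (n : ℕ) : ∀ r ∈ Set.Icc s t,
      g r ≤ (2 * K + |m| * (1 / 2) ^ n) * Real.exp (2 * B * (r - s)) := by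
    induction n with
    | zero =>
      intro r hr
      have h1 : 1 ≤ Real.exp (2 * B * (r - s)) :=
        Real.one_le_exp (mul_nonneg (by positivity) (sub_nonneg.2 hr.1))
      have := hm r hr
      have := le_abs_self m
      have h2 : |m| ≤ 2 * K + |m| := by linarith
      simp only [pow_zero, mul_one]
      nlinarith [abs_nonneg m]
    | succ n ih =>
      intro r hr
      set D := 2 * K + |m| * (1 / 2) ^ n with hD
      have h1 : ∫ q in s..r, g q ≤ ∫ q in s..r, D * Real.exp (2 * B * (q - s)) :=
        intervalIntegral.integral_mono_on hr.1 (hint r hr)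
          (Continuous.intervalIntegrable (by fun_prop) _ _)
          fun q hq => ih q ⟨hq.1, hq.2.trans hr.2⟩
      rw [intervalIntegral.integral_const_mul, integral_exp_sub] at h1
      have h2 := mul_phi (2 * B) (r - s)
      have h3 : B * ∫ q in s..r, g q ≤ D / 2 * (Real.exp (2 * B * (r - s)) - 1) := by
        calc B * ∫ q in s..r, g q ≤ B * (D * phi (2 * B) (r - s)) := by gcongr
          _ = _ := by rw [← h2]; ring
      have h4 := hg r hr
      have h5 : 0 ≤ |m| * (1 / 2) ^ n := by positivity
      have h6 : 1 ≤ Real.exp (2 * B * (r - s)) :=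
        Real.one_le_exp (mul_nonneg (by positivity) (sub_nonneg.2 hr.1))
      rw [pow_succ]
      nlinarith
  intro r hr
  have hlim : Tendsto (fun n : ℕ => (2 * K + |m| * (1 / 2) ^ n) * Real.exp (2 * B * (r - s))) atTop
      (𝓝 ((2 * K + |m| * 0) * Real.exp (2 * B * (r - s)))) :=
    ((tendsto_const_nhds.add (tendsto_const_nhds.mul
      (tendsto_pow_atTop_nhds_zero_of_lt_one (by norm_num) (by norm_num)))).mul tendsto_const_nhds)
  simpa using ge_of_tendsto' hlim fun n => hn n r hr

/-- The solution of the linear integral equation satisfied by the mean. -/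
lemma eq_of_linear_integral_equation {f : ℝ → ℝ} {s t b p f₀ C : ℝ}
    (hb : ∀ r ∈ Set.Icc s t, |f r| ≤ C) (hint : ∀ r ∈ Set.Icc s t, IntervalIntegrable f volume s r)
    (hf : ∀ r ∈ Set.Icc s t, f r = f₀ + p * (r - s) + b * ∫ q in s..r, f q) :
    ∀ r ∈ Set.Icc s t, f r = f₀ * Real.exp (b * (r - s)) + p * phi b (r - s) := by
  set h := fun r => f₀ * Real.exp (b * (r - s)) + p * phi b (r - s) with hh
  have hc : Continuous h := by
    have := continuous_phi b
    fun_prop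
  have hi (r : ℝ) : ∫ q in s..r, h q = f₀ * phi b (r - s) + p * psi b (r - s) := by
    rw [hh, intervalIntegral.integral_add, intervalIntegral.integral_const_mul,
      intervalIntegral.integral_const_mul, integral_exp_sub, integral_phi_sub]
    · exact Continuous.intervalIntegrable (by fun_prop) _ _
    · have := continuous_phi b
      exact Continuous.intervalIntegrable (by fun_prop) _ _
  obtain ⟨D, hD⟩ := isCompact_Icc.exists_bound_of_continuousOn (s := Set.Icc s t) hc.continuousOn
  -- Uniqueness: Gronwall with `K = 0` makes the difference vanish; `|b| + 1` provides a positive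
  -- rate even for `b = 0`.
  have key := le_of_le_add_mul_integral (g := fun r => |f r - h r|) (s := s) (t := t) (m := C + D)
    (K := 0) (B := |b| + 1) le_rfl (by positivity)
    (fun r hr => (abs_sub _ _).trans (add_le_add (hb r hr) (hD r hr)))
    (fun r hr => ((hint r hr).sub (hc.intervalIntegrable _ _)).abs) ?_
  · intro r hr
    have := key r hr
    simp only [mul_zero, zero_mul, abs_nonpos_iff] at this
    linarith
  · intro r hr
    have h1 : f r - h r = b * ∫ q in s..r, (f q - h q) := by
      rw [intervalIntegral.integral_sub (hint r hr) (hc.intervalIntegrable _ _), hi, hf r hr]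
      simp only [hh]
      linear_combination f₀ * mul_phi b (r - s) + p * mul_psi b (r - s)
    have h2 : |∫ q in s..r, (f q - h q)| ≤ ∫ q in s..r, |f q - h q| :=
      intervalIntegral.abs_integral_le_integral_abs hr.1
    have h3 := abs_nonneg (∫ q in s..r, (f q - h q))
    simp only [zero_add]
    rw [h1, abs_mul]
    calc |b| * |∫ q in s..r, (f q - h q)| ≤ (|b| + 1) * |∫ q in s..r, (f q - h q)| := by
          gcongr; linarith
      _ ≤ _ := by gcongr

/-! ### Measurability in time and randomness -/

section Swap

variable {Ω : Type*} {mΩ : MeasurableSpace Ω} {P : Measure Ω}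

lemma integral_intervalIntegral_swap [IsFiniteMeasure P] {Z : ℝ → Ω → ℝ}
    (hZ : Measurable (Function.uncurry Z)) {s t C : ℝ} (hst : s ≤ t)
    (hint : ∀ r ∈ Set.Icc s t, Integrable (Z r) P) (hC : ∀ r ∈ Set.Icc s t, ∫ ω, |Z r ω| ∂P ≤ C) :
    Integrable (fun ω => ∫ r in s..t, Z r ω) P ∧
      ∫ ω, (∫ r in s..t, Z r ω) ∂P = ∫ r in s..t, ∫ ω, Z r ω ∂P ∧
      IntervalIntegrable (fun r => ∫ ω, Z r ω ∂P) volume s t := by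
  have hmem : ∀ᵐ r ∂volume.restrict (Set.Ioc s t), r ∈ Set.Icc s t :=
    (ae_restrict_mem measurableSet_Ioc).mono fun r hr => Set.Ioc_subset_Icc_self hr
  have hprod : Integrable (Function.uncurry Z) ((volume.restrict (Set.Ioc s t)).prod P) := by
    rw [integrable_prod_iff hZ.aestronglyMeasurable]
    refine ⟨hmem.mono fun r hr => hint r hr, ?_⟩
    refine Integrable.of_bound (C := C)
      hZ.norm.stronglyMeasurable.integral_prod_right.aestronglyMeasurable (hmem.mono fun r hr => ?_)
    rw [Real.norm_of_nonneg (integral_nonneg fun ω => norm_nonneg _)]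
    exact hC r hr
  simp only [intervalIntegral.integral_of_le hst, intervalIntegrable_iff_integrableOn_Ioc_of_le hst]
  exact ⟨hprod.integral_prod_right, (integral_integral_swap hprod).symm, hprod.integral_prod_left⟩

/-- By continuity of paths, the condition over all times of `[s, r]` reduces to rational times
clamped to that interval; for `r < s` it is void. -/
lemma measurable_killed {Y : ℝ → Ω → ℝ} (hc : ∀ ω, Continuous fun r => Y r ω)
    (hm : ∀ r, Measurable (Y r)) (s m : ℝ) :
    Measurable (Function.uncurry fun r ω => killed (fun q => Y q ω) s m r) := by
  have hY : Measurable (Function.uncurry Y) := measurable_uncurry_of_continuous_of_measurable hc hm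
  refine Measurable.ite ?_ hY measurable_const
  have heq : {p : ℝ × Ω | ∀ q, s ≤ q → q ≤ p.1 → Y q p.2 ≤ m} =
      {p | p.1 < s} ∪ ⋂ q : ℚ, {p | Y (max s (min (q : ℝ) p.1)) p.2 ≤ m} := by
    ext ⟨r, ω⟩
    simp only [Set.mem_ofPred_eq, Set.mem_union, Set.mem_iInter]
    constructor
    · intro h
      by_cases hr : r < s
      · exact Or.inl hr
      · exact Or.inr fun q => h _ (le_max_left _ _) (max_le (not_lt.1 hr) (min_le_right _ _))
    · rintro (h | h) q hq hqr
      · exact absurd h (not_lt.2 (hq.trans hqr))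
      · have hcl : IsClosed {q : ℝ | Y (max s (min q r)) ω ≤ m} :=
          isClosed_le ((hc ω).comp (by fun_prop)) continuous_const
        have hall : (q : ℝ) ∈ {q : ℝ | Y (max s (min q r)) ω ≤ m} :=
          Rat.denseRange_cast.induction_on q hcl h
        simpa [min_eq_left hqr, max_eq_right hq] using hall
  rw [heq]
  refine (measurableSet_lt measurable_fst measurable_const).union
    (MeasurableSet.iInter fun q => measurableSet_le ?_ measurable_const)
  exact hY.comp (f := fun p : ℝ × Ω => (max s (min (q : ℝ) p.1), p.2)) (by fun_prop)

end Swap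

/-! ### The square-root process -/

section SquareRootProcess

variable {Ω : Type*} {mΩ : MeasurableSpace Ω} {P : Measure Ω} {a b c x : ℝ} {s₀ : ℝ≥0}
  {ℱ : Filtration ℝ≥0 mΩ} {W V M : ℝ≥0 → Ω → ℝ}

namespace IsSquareRootProcess

/-- Paths are set to `0` on a measurable null set and frozen at their initial value before `s₀`. The
null set need not belong to the filtration, so `Y` is only measurable and adaptedness arguments stay
with `V`. -/
lemma exists_continuous_version (h : IsSquareRootProcess P a b c s₀ x ℱ W V M) :
    ∃ Y : ℝ → Ω → ℝ, (∀ ω, Continuous fun r => Y r ω) ∧ (∀ r, Measurable (Y r)) ∧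
      (∀ r ω, 0 ≤ Y r ω) ∧ ∀ᵐ ω ∂P, ∀ r : ℝ≥0, s₀ ≤ r → Y r ω = V r ω := by
  classical
  have hgood := h.continuous.and h.nonneg
  set N := toMeasurable P {ω | ¬ (ContinuousOn (fun t => V t ω) (Set.Ici s₀) ∧
    ∀ t, s₀ ≤ t → 0 ≤ V t ω)} with hN
  have hN0 : P N = 0 := by rw [hN, measure_toMeasurable]; exact hgood
  have hNgood {ω : Ω} (hω : ω ∉ N) : ContinuousOn (fun t => V t ω) (Set.Ici s₀) ∧
      ∀ t, s₀ ≤ t → 0 ≤ V t ω := by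
    by_contra hcon
    exact hω (subset_toMeasurable _ _ hcon)
  refine ⟨fun r ω => if ω ∈ N then 0 else V (max s₀ r.toNNReal) ω, fun ω => ?_, fun r => ?_,
    fun r ω => ?_, ?_⟩
  · by_cases hω : ω ∈ N
    · simpa [hω] using continuous_const
    · simp only [hω, if_false]
      exact (hNgood hω).1.comp_continuous (f := fun r : ℝ => max s₀ r.toNNReal) (by fun_prop)
        fun r => Set.mem_Ici.2 (le_max_left _ _)
  · exact Measurable.ite (measurableSet_toMeasurable _ _) measurable_const
      ((h.adapted _ (le_max_left _ _)).mono (ℱ.le _) le_rfl)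
  · dsimp only
    split_ifs with hω
    exacts [le_rfl, (hNgood hω).2 _ (le_max_left _ _)]
  · have : ∀ᵐ ω ∂P, ω ∉ N := measure_eq_zero_iff_ae_notMem.1 hN0
    filter_upwards [this] with ω hω r hr
    simp [hω, max_eq_right hr]

lemma nonneg_init [IsProbabilityMeasure P] (h : IsSquareRootProcess P a b c s₀ x ℱ W V M) :
    0 ≤ x := by
  obtain ⟨ω, h1, h2⟩ := (h.nonneg.and h.init).exists
  exact h2 ▸ h1 s₀ le_rfl

lemma measurable_stoppedIntegrand (h : IsSquareRootProcess P a b c s₀ x ℱ W V M) {π : ℕ → ℝ≥0}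
    (hπ : Monotone π) (h0 : ∀ k, s₀ ≤ π k) (m : ℝ) (k : ℕ) :
    Measurable[ℱ (π k)] (stoppedIntegrand V (fun t ω => Real.sqrt (V t ω)) π m k) := by
  refine Measurable.ite ?_ (h.adapted _ (h0 k)).sqrt measurable_const
  have : {ω | ∀ j ≤ k, V (π j) ω ≤ m} = ⋂ j, ⋂ _ : j ≤ k, {ω | V (π j) ω ≤ m} := by
    ext; simp
  rw [this]
  refine MeasurableSet.iInter fun j => MeasurableSet.iInter fun hj => ?_
  exact measurableSet_le ((h.adapted _ (h0 j)).mono (ℱ.mono (hπ hj)) le_rfl) measurable_const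

/-- The bound holds at every `ω`, since the square root of a negative value is `0`. -/
lemma stoppedIntegrand_sq_le {π : ℕ → ℝ≥0} {m : ℝ} (hm : 0 ≤ m) (k : ℕ) (ω : Ω) :
    stoppedIntegrand V (fun t ω => Real.sqrt (V t ω)) π m k ω ^ 2 ≤ m := by
  unfold stoppedIntegrand
  split_ifs with hk
  · dsimp only
    rcases le_total 0 (V (π k) ω) with h0 | h0
    · rw [Real.sq_sqrt h0]
      exact hk k le_rfl
    · rw [Real.sqrt_eq_zero_of_nonpos h0]
      simpa using hm
  · simpa using hm

/-- Pathwise, `c` times the integrals stopped at level `m` asymptotically dominate the difference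
between the killed process and its drift. -/
lemma eventually_killed_sub_le_integral (h : IsSquareRootProcess P a b c s₀ x ℱ W V M)
    (ha : 0 ≤ a) {Y : ℝ → Ω → ℝ} (hYc : ∀ ω, Continuous fun r => Y r ω) (hY0 : ∀ r ω, 0 ≤ Y r ω)
    (hYV : ∀ᵐ ω ∂P, ∀ r : ℝ≥0, s₀ ≤ r → Y r ω = V r ω) {t : ℝ≥0} {N : ℕ → ℕ}
    {π : ℕ → ℕ → ℝ≥0} (hπ : ∀ j : ℕ, IsSubdivision s₀ t (1 / ((j : ℝ) + 1)) (N j) (π j))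
    (hlim : ∀ᵐ ω ∂P, ∀ ε : ℝ, 0 < ε → ∀ᶠ j in atTop, ∀ u, s₀ ≤ u → u ≤ t →
      |elemIntegral (fun t ω => Real.sqrt (V t ω)) W (N j) (π j) u ω - M u ω| < ε) (m : ℝ) :
    ∀ᵐ ω ∂P, ∀ ε, 0 < ε → ∀ᶠ j in atTop,
      killed (fun r => Y r ω) s₀ m t - (x + a * (t - s₀) +
        |b| * ∫ r in (s₀ : ℝ)..t, killed (fun r => Y r ω) s₀ m r) - ε ≤
      c * discreteIntegral (stoppedIntegrand V (fun t ω => Real.sqrt (V t ω)) (π j) m) W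
        (π j) (N j) ω := by
  filter_upwards [hYV, hlim, h.sde] with ω hV hM hsde ε hε
  choose τ hτ₁ hτ₂ hτ₃ hτ₄ hτ₅ using fun j =>
    exists_elemIntegral_eq V (fun t ω => Real.sqrt (V t ω)) W (hπ j) m ω
  have hmem (j k : ℕ) (hk : k ≤ N j) : s₀ ≤ π j k ∧ π j k ≤ t :=
    ⟨(hπ j).left ▸ (hπ j).mono (Nat.zero_le _), (hπ j).right ▸ (hπ j).mono hk⟩
  have hpath := eventually_killed_sub_le (y := fun r => Y r ω) (s := s₀) (t := t) (m := m)
    (b := b) (x := x) (τ := fun j => τ j) (hYc ω) (fun r => hY0 r ω) ha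
    (fun j => ⟨NNReal.coe_le_coe.2 (hτ₁ j), NNReal.coe_le_coe.2 (hτ₂ j)⟩) ?_ ?_ (half_pos hε)
  · have hε' : 0 < ε / 2 / (|c| + 1) := by positivity
    filter_upwards [hpath, hM _ hε'] with j h1 h2
    -- The time `τ j` depends on `ω`; uniform convergence in `u` is what permits evaluating there.
    have h3 := h2 (τ j) (hτ₁ j) (hτ₂ j)
    have h4 := hsde (τ j) (hτ₁ j)
    have h5 : ∫ r in (s₀ : ℝ)..τ j, (a + b * V r.toNNReal ω) =
        ∫ r in (s₀ : ℝ)..τ j, (a + b * Y r ω) := by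
      refine intervalIntegral.integral_congr fun r hr => ?_
      rw [Set.uIcc_of_le (NNReal.coe_le_coe.2 (hτ₁ j))] at hr
      have h6 : s₀ ≤ r.toNNReal := NNReal.le_toNNReal_of_coe_le hr.1
      have h7 := hV _ h6
      rw [Real.coe_toNNReal _ (s₀.coe_nonneg.trans hr.1)] at h7
      simp only [h7]
    rw [← hτ₅ j]
    set E := elemIntegral (fun t ω => Real.sqrt (V t ω)) W (N j) (π j) (τ j) ω
    have h8 : |c * (E - M (τ j) ω)| ≤ ε / 2 := by
      rw [abs_mul]
      calc |c| * |E - M (τ j) ω| ≤ (|c| + 1) * (ε / 2 / (|c| + 1)) := by gcongr; linarith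
        _ = ε / 2 := by field_simp
    have h9 := (abs_le.1 h8).1
    rw [h5, ← hV _ (hτ₁ j)] at h4
    linarith
  · intro hall j
    refine congrArg _ (hτ₃ j fun k hk => ?_)
    rw [← hV _ (hmem j k hk).1]
    exact hall _ (NNReal.coe_le_coe.2 (hmem j k hk).1) (NNReal.coe_le_coe.2 (hmem j k hk).2)
  · intro q hq hqt hqm η hη
    -- The excess over `m` persists near `q`, so a fine grid sees it at a point shortly after `q`,
    -- and `τ j` is at most that point.
    have hnear : ∀ᶠ r in 𝓝 q, m < Y r ω := (hYc ω).continuousAt.eventually (lt_mem_nhds hqm)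
    obtain ⟨δ, hδ, hδ'⟩ := Metric.eventually_nhds_iff.1 hnear
    have h1 : ∀ᶠ j : ℕ in atTop, 1 / ((j : ℝ) + 1) < min δ η :=
      tendsto_one_div_add_atTop_nhds_zero_nat.eventually (gt_mem_nhds (by positivity))
    filter_upwards [h1] with j hj
    obtain ⟨k, hk, hk1, hk2⟩ := (hπ j).exists_near (by positivity) hq hqt
    have h2 : m < V (π j k) ω := by
      rw [← hV _ (hmem j k hk).1]
      refine hδ' ?_
      rw [Real.dist_eq, abs_of_nonneg (sub_nonneg.2 hk1)]
      linarith [min_le_left δ η]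
    have h3 : (τ j : ℝ) ≤ π j k := NNReal.coe_le_coe.2 (hτ₄ j k hk h2)
    linarith [min_le_right δ η]

variable [IsProbabilityMeasure P]

/-- Expectation of the pathwise domination: the stopped integrals are centred, with second moment at
most `m * (t - s₀)` by the isometry. The level `m` disappears from the resulting inequality. -/
lemma integral_killed_le (h : IsSquareRootProcess P a b c s₀ x ℱ W V M)
    (ha : 0 ≤ a) {Y : ℝ → Ω → ℝ} (hYc : ∀ ω, Continuous fun r => Y r ω)
    (hYm : ∀ r, Measurable (Y r)) (hY0 : ∀ r ω, 0 ≤ Y r ω)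
    (hYV : ∀ᵐ ω ∂P, ∀ r : ℝ≥0, s₀ ≤ r → Y r ω = V r ω) {m : ℝ} (hm : 0 ≤ m) {t : ℝ≥0}
    (ht : s₀ ≤ t) :
    IntervalIntegrable (fun r => ∫ ω, killed (fun r => Y r ω) s₀ m r ∂P) volume s₀ t ∧
    ∫ ω, killed (fun r => Y r ω) s₀ m t ∂P ≤ x + a * (t - s₀) +
      |b| * ∫ r in (s₀ : ℝ)..t, ∫ ω, killed (fun r => Y r ω) s₀ m r ∂P := by
  have hst : (s₀ : ℝ) ≤ t := NNReal.coe_le_coe.2 ht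
  set Z : ℝ → Ω → ℝ := fun r ω => killed (fun r => Y r ω) s₀ m r
  have hZ : Measurable (Function.uncurry Z) := measurable_killed hYc hYm s₀ m
  have hZ0 (r : ℝ) (ω : Ω) : 0 ≤ Z r ω := killed_nonneg (fun r => hY0 r ω) r
  have hZm {r : ℝ} (hr : s₀ ≤ r) (ω : Ω) : Z r ω ≤ m := killed_le hm hr
  have hZb {r : ℝ} (hr : s₀ ≤ r) (ω : Ω) : |Z r ω| ≤ m := by
    rw [abs_of_nonneg (hZ0 r ω)]
    exact hZm hr ω
  have hZr (r : ℝ) : Measurable (Z r) := hZ.of_uncurry_left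
  have hZint {r : ℝ} (hr : s₀ ≤ r) : Integrable (Z r) P :=
    Integrable.of_bound (hZr r).aestronglyMeasurable m (Eventually.of_forall (hZb hr))
  obtain ⟨hI, hswap, hii⟩ := integral_intervalIntegral_swap (P := P) hZ hst (C := m)
    (fun r hr => hZint hr.1) fun r hr => by
      simpa using integral_mono (μ := P) (hZint hr.1).abs (integrable_const m) (hZb hr.1)
  refine ⟨hii, ?_⟩
  obtain ⟨N, n, π, hπ, -, -, hlim⟩ := h.integral.exists_subdivisions ht le_rfl
  have hπ0 (j k : ℕ) : s₀ ≤ π j k := (hπ j).left ▸ (hπ j).mono (Nat.zero_le _)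
  set ξ := fun j => stoppedIntegrand V (fun t ω => Real.sqrt (V t ω)) (π j) m
  have hξm (j k : ℕ) : Measurable[ℱ (π j k)] (ξ j k) :=
    h.measurable_stoppedIntegrand (hπ j).mono (hπ0 j) m k
  have hξsq (j k : ℕ) (ω : Ω) : ξ j k ω ^ 2 ≤ m := stoppedIntegrand_sq_le hm k ω
  have hξ2 (j k : ℕ) : MemLp (ξ j k) 2 P := by
    refine MemLp.of_bound ((hξm j k).mono (ℱ.le _) le_rfl).aestronglyMeasurable (Real.sqrt m)
      (Eventually.of_forall fun ω => ?_)
    exact Real.abs_le_sqrt (hξsq j k ω)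
  have hS (j : ℕ) := discreteIntegral_secondMoment h.brownian (hπ j).mono (hξm j) (hξ2 j) (N j)
  have hSb (j : ℕ) := discreteIntegral_secondMoment_le h.brownian (hπ j) (hξm j) (hξ2 j) (C := m)
    fun k _ => by
      simpa using integral_mono (μ := P) (hξ2 j k).integrable_sq (integrable_const m) (hξsq j k)
  have key := integral_nonpos_of_eventually_le (P := P)
    (X := fun j ω => c * discreteIntegral (ξ j) W (π j) (N j) ω)
    (D := fun ω => Z t ω - (x + a * (t - s₀) + |b| * ∫ r in (s₀ : ℝ)..t, Z r ω))
    (C := c ^ 2 * (m * (t - s₀))) (K₀ := m + (|x| + a * (t - s₀) + |b| * (m * (t - s₀))))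
    (fun j => (hS j).1.const_mul c) (fun j => ?_) (fun j => ?_) ?_ (fun ω => ?_)
    (h.eventually_killed_sub_le_integral ha hYc hY0 hYV hπ hlim m)
  · have hR : Integrable (fun ω => x + a * (t - s₀) + |b| * ∫ r in (s₀ : ℝ)..t, Z r ω) P :=
      (integrable_const _).add (hI.const_mul _)
    rw [integral_sub (hZint hst) hR, integral_add (integrable_const _) (hI.const_mul _),
      integral_const_mul, hswap] at key
    simpa using key
  · simp_rw [mul_pow]
    rw [integral_const_mul]
    exact mul_le_mul_of_nonneg_left (hSb j) (sq_nonneg c)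
  · rw [integral_const_mul]
    have := setIntegral_discreteIntegral h.brownian (hπ j).mono (hξm j) (hξ2 j)
      (Nat.zero_le (N j)) MeasurableSet.univ
    simp only [Measure.restrict_univ, discreteIntegral, Finset.range_zero, Finset.sum_empty,
      sub_zero] at this
    unfold discreteIntegral
    rw [this, mul_zero]
  · exact (hZint hst).1.sub (aestronglyMeasurable_const.add (hI.1.const_mul _))
  · have h1 : |∫ r in (s₀ : ℝ)..t, Z r ω| ≤ m * (t - s₀) := by
      have := intervalIntegral.norm_integral_le_of_norm_le_const (a := (s₀ : ℝ)) (b := t)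
        (f := fun r => Z r ω) (C := m) fun r hr => by
          rw [Set.uIoc_of_le hst] at hr
          exact hZb hr.1.le ω
      rwa [abs_of_nonneg (sub_nonneg.2 hst)] at this
    have h2 : |a * ((t : ℝ) - s₀)| = a * (t - s₀) := abs_of_nonneg (by
      have := sub_nonneg.2 hst
      positivity)
    calc |Z t ω - (x + a * (t - s₀) + |b| * ∫ r in (s₀ : ℝ)..t, Z r ω)|
        ≤ |Z t ω| + (|x| + |a * ((t : ℝ) - s₀)| + |(|b| * ∫ r in (s₀ : ℝ)..t, Z r ω)|) :=
          (abs_sub _ _).trans (add_le_add le_rfl ((abs_add_le _ _).trans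
            (add_le_add (abs_add_le _ _) le_rfl)))
      _ ≤ _ := by
          rw [h2, abs_mul, abs_abs]
          gcongr
          exact hZb hst ω

/-- The first moment of the process is bounded on compact time intervals. -/
lemma exists_integral_le (h : IsSquareRootProcess P a b c s₀ x ℱ W V M)
    (ha : 0 ≤ a) {Y : ℝ → Ω → ℝ} (hYc : ∀ ω, Continuous fun r => Y r ω)
    (hYm : ∀ r, Measurable (Y r)) (hY0 : ∀ r ω, 0 ≤ Y r ω)
    (hYV : ∀ᵐ ω ∂P, ∀ r : ℝ≥0, s₀ ≤ r → Y r ω = V r ω) {T : ℝ≥0} (hT : s₀ ≤ T) :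
    ∃ C : ℝ, ∀ r ∈ Set.Icc (s₀ : ℝ) T, Integrable (Y r) P ∧ ∫ ω, Y r ω ∂P ≤ C := by
  have hx := h.nonneg_init
  have hsT : (0 : ℝ) ≤ T - s₀ := sub_nonneg.2 (NNReal.coe_le_coe.2 hT)
  set K := x + a * (T - s₀)
  have hK : 0 ≤ K := by positivity
  -- This Gronwall bound does not depend on the killing level, so Fatou can be applied as the level
  -- increases.
  set C := 2 * K * Real.exp (2 * (|b| + 1) * (T - s₀))
  have hC0 : 0 ≤ C := by positivity
  set Z : ℕ → ℝ → Ω → ℝ := fun m r ω => killed (fun r => Y r ω) s₀ m r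
  have hZ0 (m : ℕ) (r : ℝ) (ω : Ω) : 0 ≤ Z m r ω := killed_nonneg (fun r => hY0 r ω) r
  have hZr (m : ℕ) (r : ℝ) : Measurable (Z m r) :=
    (measurable_killed hYc hYm s₀ m).of_uncurry_left
  have hZint (m : ℕ) {r : ℝ} (hr : s₀ ≤ r) : Integrable (Z m r) P :=
    Integrable.of_bound (hZr m r).aestronglyMeasurable m (Eventually.of_forall fun ω => by
      rw [Real.norm_of_nonneg (hZ0 m r ω)]
      exact killed_le m.cast_nonneg hr)
  have hb (m : ℕ) : ∀ r ∈ Set.Icc (s₀ : ℝ) T, ∫ ω, Z m r ω ∂P ≤ C := by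
    have hnn (r : ℝ) : 0 ≤ ∫ ω, Z m r ω ∂P := integral_nonneg (hZ0 m r)
    have hkey (r : ℝ) (hr : r ∈ Set.Icc (s₀ : ℝ) T) := by
      have := h.integral_killed_le ha hYc hYm hY0 hYV (m := m) m.cast_nonneg (t := r.toNNReal)
        (NNReal.le_toNNReal_of_coe_le hr.1)
      rwa [Real.coe_toNNReal _ (s₀.coe_nonneg.trans hr.1)] at this
    have hG := le_of_le_add_mul_integral (g := fun r => ∫ ω, Z m r ω ∂P) (s := s₀) (t := T)
      (m := m) (K := K) (B := |b| + 1) hK (by positivity) (fun r hr => ?_)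
      (fun r hr => (hkey r hr).1) (fun r hr => ?_)
    · intro r hr
      refine (hG r hr).trans ?_
      have := hr.2
      simp only [C]
      gcongr
    · simpa using integral_mono (μ := P) (hZint m hr.1) (integrable_const (m : ℝ))
        fun ω => killed_le m.cast_nonneg hr.1
    · refine (hkey r hr).2.trans ?_
      have h1 : 0 ≤ ∫ q in (s₀ : ℝ)..r, ∫ ω, Z m q ω ∂P :=
        intervalIntegral.integral_nonneg hr.1 fun q _ => hnn q
      have := hr.2
      simp only [K]
      gcongr
      linarith
  refine ⟨C, fun r hr => ?_⟩
  -- A continuous path is bounded on `[s₀, r]`, hence is not killed once `m` exceeds the bound.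
  have hlim (ω : Ω) : Tendsto (fun m : ℕ => Z m r ω) atTop (𝓝 (Y r ω)) := by
    obtain ⟨D, hD⟩ := (isCompact_Icc (a := (s₀ : ℝ)) (b := r)).exists_bound_of_continuousOn
      (hYc ω).continuousOn
    obtain ⟨m₀, hm₀⟩ := exists_nat_ge D
    refine tendsto_const_nhds.congr' ?_
    filter_upwards [eventually_ge_atTop m₀] with m hm
    have : ∀ q, (s₀ : ℝ) ≤ q → q ≤ r → Y q ω ≤ m := fun q hq hqr =>
      (le_abs_self _).trans ((hD q ⟨hq, hqr⟩).trans (hm₀.trans (by exact_mod_cast hm)))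
    simp only [Z, killed]
    rw [if_pos this]
  have hl : ∫⁻ ω, ENNReal.ofReal (Y r ω) ∂P ≤ ENNReal.ofReal C := by
    calc ∫⁻ ω, ENNReal.ofReal (Y r ω) ∂P
        = ∫⁻ ω, liminf (fun m => ENNReal.ofReal (Z m r ω)) atTop ∂P :=
          lintegral_congr fun ω =>
            (((ENNReal.continuous_ofReal.tendsto _).comp (hlim ω)).liminf_eq).symm
      _ ≤ liminf (fun m => ∫⁻ ω, ENNReal.ofReal (Z m r ω) ∂P) atTop :=
          lintegral_liminf_le fun m => (hZr m r).ennreal_ofReal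
      _ ≤ ENNReal.ofReal C := by
          refine liminf_le_of_le (by isBoundedDefault) fun y hy => ?_
          obtain ⟨m, hm⟩ := hy.exists
          refine hm.trans ?_
          rw [← ofReal_integral_eq_lintegral_ofReal (hZint m hr.1)
            (Eventually.of_forall (hZ0 m r))]
          exact ENNReal.ofReal_le_ofReal (hb m r hr)
  refine ⟨⟨(hYm r).aestronglyMeasurable, ?_⟩, ?_⟩
  · rw [hasFiniteIntegral_iff_ofReal (Eventually.of_forall fun ω => hY0 r ω)]
    exact hl.trans_lt ENNReal.ofReal_lt_top
  · rw [integral_eq_lintegral_of_nonneg_ae (Eventually.of_forall fun ω => hY0 r ω)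
      (hYm r).aestronglyMeasurable]
    exact ENNReal.toReal_le_of_le_ofReal hC0 hl

/-- The stochastic integral is a true martingale. -/
lemma setIntegral_martingale (h : IsSquareRootProcess P a b c s₀ x ℱ W V M) (ha : 0 ≤ a)
    {s t : ℝ≥0} (hs : s₀ ≤ s) (ht : s ≤ t) :
    Integrable (fun ω => M t ω - M s ω) P ∧
      ∀ A, MeasurableSet[ℱ s] A → ∫ ω in A, (M t ω - M s ω) ∂P = 0 := by
  obtain ⟨Y, hYc, hYm, hY0, hYV⟩ := h.exists_continuous_version
  obtain ⟨C, hC⟩ := h.exists_integral_le ha hYc hYm hY0 hYV (hs.trans ht)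
  obtain ⟨N, n, π, hπ, hn, hπs, hlim⟩ := h.integral.exists_subdivisions hs ht
  have hπ0 (j k : ℕ) : s₀ ≤ π j k := (hπ j).left ▸ (hπ j).mono (Nat.zero_le _)
  set ξ : ℕ → ℕ → Ω → ℝ := fun j k ω => Real.sqrt (V (π j k) ω)
  have hξm (j k : ℕ) : Measurable[ℱ (π j k)] (ξ j k) := (h.adapted _ (hπ0 j k)).sqrt
  have hξsq (j k : ℕ) : (fun ω => ξ j k ω ^ 2) =ᵐ[P] Y (π j k) := by
    filter_upwards [hYV] with ω hω
    rw [hω _ (hπ0 j k), Real.sq_sqrt]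
    rw [← hω _ (hπ0 j k)]
    exact hY0 _ ω
  have hξ2 (j k : ℕ) : MemLp (ξ j k) 2 P := by
    rw [memLp_two_iff_integrable_sq ((hξm j k).mono (ℱ.le _) le_rfl).aestronglyMeasurable]
    -- Grid points of index beyond `N j` may lie after `t`, where `C` says nothing; only square
    -- integrability is needed there.
    obtain ⟨C', hC'⟩ := h.exists_integral_le ha hYc hYm hY0 hYV (hπ0 j k)
    exact ((hC' (π j k) ⟨NNReal.coe_le_coe.2 (hπ0 j k), le_rfl⟩).1).congr (hξsq j k).symm
  have hS (j k : ℕ) :=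
    (discreteIntegral_secondMoment h.brownian (hπ j).mono (hξm j) (hξ2 j) k).1
  have hmoment (j k : ℕ) (hk : k ≤ N j) : ∫ ω, ξ j k ω ^ 2 ∂P ≤ C := by
    rw [integral_congr_ae (hξsq j k)]
    exact (hC _ ⟨NNReal.coe_le_coe.2 (hπ0 j k),
      NNReal.coe_le_coe.2 ((hπ j).right ▸ (hπ j).mono hk)⟩).2
  have hbt (j : ℕ) := discreteIntegral_secondMoment_le h.brownian (hπ j) (hξm j) (hξ2 j)
    fun k hk => hmoment j k hk.le
  have hbs (j : ℕ) : ∫ ω, discreteIntegral (ξ j) W (π j) (n j) ω ^ 2 ∂P ≤ C * (s - s₀) :=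
    discreteIntegral_secondMoment_le h.brownian
      (⟨(hπ j).mono, (hπ j).left, hπs j, fun k hk => (hπ j).mesh k (hk.trans_le (hn j))⟩ :
        IsSubdivision s₀ s (1 / ((j : ℝ) + 1)) (n j) (π j)) (hξm j) (hξ2 j)
      fun k hk => hmoment j k (hk.le.trans (hn j))
  set X : ℕ → Ω → ℝ := fun j ω =>
    discreteIntegral (ξ j) W (π j) (N j) ω - discreteIntegral (ξ j) W (π j) (n j) ω
  have hX (j : ℕ) : MemLp (X j) 2 P := (hS j (N j)).sub (hS j (n j))
  -- The crude bound `(u - v)² ≤ 2 u² + 2 v²` suffices, as any bound uniform in `j` will do.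
  have hXb (j : ℕ) : ∫ ω, X j ω ^ 2 ∂P ≤ 2 * (C * (t - s₀)) + 2 * (C * (s - s₀)) := by
    calc ∫ ω, X j ω ^ 2 ∂P ≤ ∫ ω, (2 * discreteIntegral (ξ j) W (π j) (N j) ω ^ 2 +
          2 * discreteIntegral (ξ j) W (π j) (n j) ω ^ 2) ∂P := by
          refine integral_mono (hX j).integrable_sq
            (((hS j (N j)).integrable_sq.const_mul 2).add
              ((hS j (n j)).integrable_sq.const_mul 2)) fun ω => ?_
          simp only [X]
          nlinarith [sq_nonneg (discreteIntegral (ξ j) W (π j) (N j) ω +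
            discreteIntegral (ξ j) W (π j) (n j) ω)]
      _ ≤ _ := by
          rw [integral_add ((hS j (N j)).integrable_sq.const_mul 2)
            ((hS j (n j)).integrable_sq.const_mul 2), integral_const_mul, integral_const_mul]
          linarith [hbt j, hbs j]
  have hXlim : ∀ᵐ ω ∂P, Tendsto (fun j => X j ω) atTop (𝓝 (M t ω - M s ω)) := by
    filter_upwards [hlim] with ω hω
    have hconv (u : ℝ≥0) (k : ℕ → ℕ) (hk : ∀ j, k j ≤ N j) (hu : ∀ j, π j (k j) = u)
        (h0 : s₀ ≤ u) (h1 : u ≤ t) :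
        Tendsto (fun j => discreteIntegral (ξ j) W (π j) (k j) ω) atTop (𝓝 (M u ω)) := by
      refine Metric.tendsto_nhds.2 fun ε hε => ?_
      filter_upwards [hω ε hε] with j hj
      have h2 := elemIntegral_eq_discreteIntegral (fun t ω => Real.sqrt (V t ω)) W (hπ j).mono
        (hk j) ω
      rw [hu j] at h2
      rw [Real.dist_eq, ← h2]
      exact hj u h0 h1
    exact (hconv t N (fun _ => le_rfl) (fun j => (hπ j).right) (hs.trans ht) le_rfl).sub
      (hconv s n hn hπs hs ht)
  refine ⟨(memLp_two_of_tendsto hX hXb hXlim).1.integrable one_le_two, fun A hA => ?_⟩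
  refine setIntegral_eq_zero_of_tendsto hX hXb hXlim fun j => ?_
  exact setIntegral_discreteIntegral h.brownian (hπ j).mono (hξm j) (hξ2 j) (hn j)
    ((hπs j).symm ▸ hA)

/-- Integrals of the process over events known at an earlier time. -/
lemma setIntegral (h : IsSquareRootProcess P a b c s₀ x ℱ W V M) (ha : 0 ≤ a)
    {s t : ℝ≥0} (hs : s₀ ≤ s) (ht : s ≤ t) :
    (Integrable (V s) P ∧ Integrable (timeIntegral V s t) P ∧ Integrable (V t) P) ∧
    ∀ A, MeasurableSet[ℱ s] A →
      ∫ ω in A, timeIntegral V s t ω ∂P =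
        ∫ ω in A, (V s ω * phi b (t - s) + a * psi b (t - s)) ∂P ∧
      ∫ ω in A, V t ω ∂P =
        ∫ ω in A, (V s ω * Real.exp (b * (t - s)) + a * phi b (t - s)) ∂P := by
  obtain ⟨Y, hYc, hYm, hY0, hYV⟩ := h.exists_continuous_version
  obtain ⟨C, hC⟩ := h.exists_integral_le ha hYc hYm hY0 hYV (hs.trans ht)
  have hs' : (s₀ : ℝ) ≤ s := NNReal.coe_le_coe.2 hs
  have hst : (s : ℝ) ≤ t := NNReal.coe_le_coe.2 ht
  have hY : Measurable (Function.uncurry Y) :=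
    measurable_uncurry_of_continuous_of_measurable hYc hYm
  have hVs : Y s =ᵐ[P] V s := hYV.mono fun ω hω => hω s hs
  have hVt : Y t =ᵐ[P] V t := hYV.mono fun ω hω => hω t (hs.trans ht)
  have hVint : Integrable (V s) P := (hC s ⟨hs', hst⟩).1.congr hVs
  have hint (r : ℝ) (hr : r ∈ Set.Icc (s : ℝ) t) : Integrable (Y r) P :=
    (hC r ⟨hs'.trans hr.1, hr.2⟩).1
  have hbd (A : Set Ω) (r : ℝ) (hr : r ∈ Set.Icc (s : ℝ) t) : ∫ ω in A, |Y r ω| ∂P ≤ C := by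
    refine (setIntegral_le_integral (hint r hr).abs
      (Eventually.of_forall fun ω => abs_nonneg _)).trans ?_
    simp_rw [abs_of_nonneg (hY0 r _)]
    exact (hC r ⟨hs'.trans hr.1, hr.2⟩).2
  have hswap (A : Set Ω) (r : ℝ) (hr : r ∈ Set.Icc (s : ℝ) t) :=
    integral_intervalIntegral_swap (P := P.restrict A) hY hr.1 (C := C)
      (fun q hq => (hint q ⟨hq.1, hq.2.trans hr.2⟩).integrableOn)
      fun q hq => hbd A q ⟨hq.1, hq.2.trans hr.2⟩
  have hintegral (r : ℝ≥0) (hr : s ≤ r) : ∀ᵐ ω ∂P,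
      timeIntegral V s r ω = ∫ q in (s : ℝ)..r, Y q ω := by
    filter_upwards [hYV] with ω hω
    refine intervalIntegral.integral_congr fun q hq => ?_
    rw [Set.uIcc_of_le (NNReal.coe_le_coe.2 hr)] at hq
    have h7 := hω _ (NNReal.le_toNNReal_of_coe_le (hs'.trans hq.1))
    rw [Real.coe_toNNReal _ (s.coe_nonneg.trans hq.1)] at h7
    exact h7.symm
  have hsde (r : ℝ≥0) (hr : s ≤ r) : ∀ᵐ ω ∂P,
      Y r ω = Y s ω + a * (r - s) + b * (∫ q in (s : ℝ)..r, Y q ω) + c * (M r ω - M s ω) := by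
    filter_upwards [h.sde, hYV] with ω h1 h2
    have h3 (u : ℝ≥0) (hu : s₀ ≤ u) : ∫ q in (s₀ : ℝ)..u, (a + b * V q.toNNReal ω) =
        a * (u - s₀) + b * ∫ q in (s₀ : ℝ)..u, Y q ω := by
      have h4 : ∫ q in (s₀ : ℝ)..u, (a + b * V q.toNNReal ω) =
          ∫ q in (s₀ : ℝ)..u, (a + b * Y q ω) := by
        refine intervalIntegral.integral_congr fun q hq => ?_
        rw [Set.uIcc_of_le (NNReal.coe_le_coe.2 hu)] at hq
        have h7 := h2 _ (NNReal.le_toNNReal_of_coe_le hq.1)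
        rw [Real.coe_toNNReal _ (s₀.coe_nonneg.trans hq.1)] at h7
        simp only [h7]
      rw [h4, intervalIntegral.integral_add (by simp)
        (((hYc ω).intervalIntegrable _ _).const_mul b)]
      simp [mul_comm]
    have h5 := h1 r (hs.trans hr)
    have h6 := h1 s hs
    rw [h3 r (hs.trans hr), ← h2 r (hs.trans hr)] at h5
    rw [h3 s hs, ← h2 s hs] at h6
    have h7 := intervalIntegral.integral_add_adjacent_intervals
      ((hYc ω).intervalIntegrable (μ := volume) s₀ s) ((hYc ω).intervalIntegrable s r)
    linear_combination h5 - h6 - b * h7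
  have htint : Integrable (timeIntegral V s t) P := by
    have := (hswap Set.univ t ⟨hst, le_rfl⟩).1
    rw [Measure.restrict_univ] at this
    exact this.congr ((hintegral t ht).mono fun ω hω => hω.symm)
  refine ⟨⟨hVint, htint, (hint t ⟨hst, le_rfl⟩).congr hVt⟩, fun A hA => ?_⟩
  set f : ℝ → ℝ := fun r => ∫ ω in A, Y r ω ∂P
  set p := a * P.real A
  -- The equation is integrated over `A`: the martingale term vanishes and Fubini exchanges the time
  -- integral with the expectation.
  have hf : ∀ r ∈ Set.Icc (s : ℝ) t, f r = f s + p * (r - s) + b * ∫ q in (s : ℝ)..r, f q := by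
    intro r hr
    lift r to ℝ≥0 using s.coe_nonneg.trans hr.1
    have hr' : s ≤ r := NNReal.coe_le_coe.1 hr.1
    obtain ⟨h1, h2, -⟩ := hswap A r hr
    obtain ⟨h3, h4⟩ := h.setIntegral_martingale ha hs hr'
    have h5 : IntegrableOn (Y s) A P := (hint s ⟨le_rfl, hst⟩).integrableOn
    have h6 : ∫ ω in A, (Y s ω + a * (r - s)) ∂P = f s + p * (r - s) := by
      rw [integral_add h5 (integrable_const _)]
      simp only [integral_const, measureReal_restrict_apply_univ, smul_eq_mul, f, p]
      ring
    have h7 : Integrable (fun ω => Y s ω + a * (r - s)) (P.restrict A) :=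
      h5.add (integrable_const _)
    have h8 : Integrable (fun ω => Y s ω + a * (r - s) + b * ∫ q in (s : ℝ)..r, Y q ω)
        (P.restrict A) := h7.add (h1.const_mul b)
    have h9 : f r = ∫ ω in A, (Y s ω + a * (r - s) + b * (∫ q in (s : ℝ)..r, Y q ω) +
        c * (M r ω - M s ω)) ∂P := integral_congr_ae (ae_restrict_of_ae (hsde r hr'))
    rw [h9, integral_add h8 (h3.const_mul c).integrableOn, integral_add h7 (h1.const_mul b),
      integral_const_mul, integral_const_mul, h4 A hA, h2, h6, mul_zero, add_zero]
  have hsol := eq_of_linear_integral_equation (C := C)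
    (fun r hr => (abs_integral_le_integral_abs).trans (hbd A r hr))
    (fun r hr => (hswap A r hr).2.2) hf
  have hlin (u v : ℝ) : ∫ ω in A, (V s ω * u + a * v) ∂P = f s * u + p * v := by
    rw [integral_add (hVint.mul_const _).integrableOn (integrable_const _), integral_mul_const,
      ← integral_congr_ae (ae_restrict_of_ae hVs)]
    simp only [integral_const, measureReal_restrict_apply_univ, smul_eq_mul, f, p]
    ring
  rw [hlin, hlin]
  constructor
  -- The integrated process comes from integrating the explicit solution in time, which turns `exp`
  -- into `phi` and `phi` into `psi`.
  · rw [integral_congr_ae (ae_restrict_of_ae (hintegral t ht)), (hswap A t ⟨hst, le_rfl⟩).2.1,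
      intervalIntegral.integral_congr (g := fun r =>
        f s * Real.exp (b * (r - s)) + p * phi b (r - s)) fun r hr =>
        hsol r (Set.uIcc_of_le hst ▸ hr), intervalIntegral.integral_add,
      intervalIntegral.integral_const_mul, intervalIntegral.integral_const_mul, integral_exp_sub,
      integral_phi_sub]
    · exact Continuous.intervalIntegrable (by fun_prop) _ _
    · have := continuous_phi b
      exact Continuous.intervalIntegrable (by fun_prop) _ _
  · rw [← integral_congr_ae (ae_restrict_of_ae hVt)]
    exact hsol t ⟨hst, le_rfl⟩

end IsSquareRootProcess

end SquareRootProcess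

/-! ### The conditional means -/

lemma hasMean_of_integral {Ω : Type*} {mΩ : MeasurableSpace Ω} {P : Measure Ω}
    [IsProbabilityMeasure P] {X Y : Ω → ℝ} {v : ℝ} {g : ℝ → ℝ} (hX : Integrable X P)
    (hY : ∀ᵐ ω ∂P, Y ω = v)
    (h : ∫ ω in Set.univ, X ω ∂P = ∫ ω in Set.univ, g (Y ω) ∂P) : HasMean P X (g v) := by
  refine ⟨hX, ?_⟩
  rw [Measure.restrict_univ] at h
  rw [h, integral_congr_ae (g := fun _ => g v) (hY.mono fun ω hω => by simp [hω])]
  simp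

lemma _root_.MeasureTheory.Integrable.mul_const_add_const {Ω : Type*} {mΩ : MeasurableSpace Ω}
    {P : Measure Ω} [IsProbabilityMeasure P] {Y : Ω → ℝ} (hY : Integrable Y P) (u w : ℝ) :
    Integrable (fun ω => Y ω * u + w) P :=
  (hY.mul_const u).add (integrable_const w)

end SquareRoot
end

open SquareRoot in
theorem proposition2 {Ω : Type*} [mΩ : MeasurableSpace Ω] (P : Measure Ω) [IsProbabilityMeasure P]
    (a b c V₀ v : ℝ) (ha : 0 ≤ a) (hV₀ : 0 ≤ V₀) (hv : 0 ≤ v)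
    (n : ℕ) (t : Fin (n + 1) → ℝ≥0) (ht : StrictMono t) (ht0 : t 0 = 0) (i : Fin n) :
    -- the scheme started from `V₀` at time `0`: conditional means given its value at time `t i`
    (c ≠ 0 → ∀ (ℱ : Filtration (Fin (n + 1)) mΩ) (V : Fin (n + 1) → Ω → ℝ) (U Z : Fin n → Ω → ℝ),
      SquareRoot.IsIViScheme P a b c t 0 V₀ ℱ V U Z →
      SquareRoot.HasCondMean P (U i) (V i.castSucc) (fun y =>
        y * SquareRoot.phi b (t i.succ - t i.castSucc)
          + a * SquareRoot.psi b (t i.succ - t i.castSucc)) ∧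
      SquareRoot.HasCondMean P (Z i) (V i.castSucc) (fun _ => 0) ∧
      SquareRoot.HasCondMean P (V i.succ) (V i.castSucc) (fun y =>
        y * Real.exp (b * (t i.succ - t i.castSucc))
          + a * SquareRoot.phi b (t i.succ - t i.castSucc))) ∧
    -- the scheme started from `v` at time `t i`
    (c ≠ 0 → ∀ (ℱ : Filtration (Fin (n + 1)) mΩ) (V : Fin (n + 1) → Ω → ℝ) (U Z : Fin n → Ω → ℝ),
      SquareRoot.IsIViScheme P a b c t i.castSucc v ℱ V U Z →
      SquareRoot.HasMean P (U i)
        (v * SquareRoot.phi b (t i.succ - t i.castSucc)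
          + a * SquareRoot.psi b (t i.succ - t i.castSucc)) ∧
      SquareRoot.HasMean P (Z i) 0 ∧
      SquareRoot.HasMean P (V i.succ)
        (v * Real.exp (b * (t i.succ - t i.castSucc))
          + a * SquareRoot.phi b (t i.succ - t i.castSucc))) ∧
    -- the square-root process started from `V₀` at time `0`: conditional means given its value at
    -- time `t i`
    (∀ (ℱ : Filtration ℝ≥0 mΩ) (W V M : ℝ≥0 → Ω → ℝ),
      SquareRoot.IsSquareRootProcess P a b c 0 V₀ ℱ W V M →
      SquareRoot.HasCondMean P (SquareRoot.timeIntegral V (t i.castSucc) (t i.succ))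
        (V (t i.castSucc)) (fun y =>
          y * SquareRoot.phi b (t i.succ - t i.castSucc)
            + a * SquareRoot.psi b (t i.succ - t i.castSucc)) ∧
      SquareRoot.HasCondMean P (fun ω => M (t i.succ) ω - M (t i.castSucc) ω)
        (V (t i.castSucc)) (fun _ => 0) ∧
      SquareRoot.HasCondMean P (V (t i.succ)) (V (t i.castSucc)) (fun y =>
        y * Real.exp (b * (t i.succ - t i.castSucc))
          + a * SquareRoot.phi b (t i.succ - t i.castSucc))) ∧
    -- the square-root process started from `v` at time `t i`
    (∀ (ℱ : Filtration ℝ≥0 mΩ) (W V M : ℝ≥0 → Ω → ℝ),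
      SquareRoot.IsSquareRootProcess P a b c (t i.castSucc) v ℱ W V M →
      SquareRoot.HasMean P (SquareRoot.timeIntegral V (t i.castSucc) (t i.succ))
        (v * SquareRoot.phi b (t i.succ - t i.castSucc)
          + a * SquareRoot.psi b (t i.succ - t i.castSucc)) ∧
      SquareRoot.HasMean P (fun ω => M (t i.succ) ω - M (t i.castSucc) ω) 0 ∧
      SquareRoot.HasMean P (V (t i.succ))
        (v * Real.exp (b * (t i.succ - t i.castSucc))
          + a * SquareRoot.phi b (t i.succ - t i.castSucc))) := by
  have hi : t i.castSucc ≤ t i.succ := ht.monotone Fin.castSucc_lt_succ.le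
  refine ⟨fun hc ℱ V U Z h => ?_, fun hc ℱ V U Z h => ?_, fun ℱ W V M h => ?_,
    fun ℱ W V M h => ?_⟩
  · have hV := (h.nonneg_integrable ha hc ht hV₀ i.castSucc (Fin.zero_le _)).2
    have hm := h.measurable_V i.castSucc (Fin.zero_le _)
    obtain ⟨⟨h1, h2, h3⟩, h4⟩ := h.setIntegral ha hc ht hV₀ i (Fin.zero_le _)
    refine ⟨?_, ?_, ?_⟩
    · exact hasCondMean_of_setIntegral (ℱ.le _) hm (by fun_prop) h1
        (hV.mul_const_add_const _ _) fun A hA => (h4 A hA).1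
    · exact hasCondMean_of_setIntegral (ℱ.le _) hm measurable_const h2 (integrable_const _)
        fun A hA => by simpa using (h4 A hA).2.1
    · exact hasCondMean_of_setIntegral (ℱ.le _) hm (by fun_prop) h3
        (hV.mul_const_add_const _ _) fun A hA => (h4 A hA).2.2
  · obtain ⟨⟨h1, h2, h3⟩, h4⟩ := h.setIntegral ha hc ht hv i le_rfl
    obtain ⟨h5, h6, h7⟩ := h4 Set.univ MeasurableSet.univ
    refine ⟨?_, ?_, ?_⟩
    · exact hasMean_of_integral (g := fun y => y * phi b (t i.succ - t i.castSucc)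
        + a * psi b (t i.succ - t i.castSucc)) h1 h.init h5
    · exact hasMean_of_integral (g := fun _ => 0) h2 h.init (by simpa using h6)
    · exact hasMean_of_integral (g := fun y => y * Real.exp (b * (t i.succ - t i.castSucc))
        + a * phi b (t i.succ - t i.castSucc)) h3 h.init h7
  · have hm := h.adapted (t i.castSucc) (zero_le)
    obtain ⟨⟨hV, h1, h3⟩, h4⟩ := h.setIntegral ha (zero_le (a := t i.castSucc)) hi
    obtain ⟨h2, h5⟩ := h.setIntegral_martingale ha (zero_le (a := t i.castSucc)) hi
    refine ⟨?_, ?_, ?_⟩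
    · exact hasCondMean_of_setIntegral (ℱ.le _) hm (by fun_prop) h1
        (hV.mul_const_add_const _ _) fun A hA => (h4 A hA).1
    · exact hasCondMean_of_setIntegral (ℱ.le _) hm measurable_const h2 (integrable_const _)
        fun A hA => by simpa using h5 A hA
    · exact hasCondMean_of_setIntegral (ℱ.le _) hm (by fun_prop) h3
        (hV.mul_const_add_const _ _) fun A hA => (h4 A hA).2
  · obtain ⟨⟨hV, h1, h3⟩, h4⟩ := h.setIntegral ha le_rfl hi
    obtain ⟨h2, h5⟩ := h.setIntegral_martingale ha le_rfl hi
    obtain ⟨h6, h7⟩ := h4 Set.univ MeasurableSet.univ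
    refine ⟨?_, ?_, ?_⟩
    · exact hasMean_of_integral (g := fun y => y * phi b (t i.succ - t i.castSucc)
        + a * psi b (t i.succ - t i.castSucc)) h1 h.init h6
    · exact hasMean_of_integral (g := fun _ => 0) h2 h.init
        (by simpa using h5 Set.univ MeasurableSet.univ)
    · exact hasMean_of_integral (g := fun y => y * Real.exp (b * (t i.succ - t i.castSucc))
        + a * phi b (t i.succ - t i.castSucc)) h3 h.init h7
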